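/- Let $N\ge 3$ and $k\ge 2$ be integers, let $0<\rho<1$, and let $\Omega_\rho=\{x\in\mathbb R^N:\rho<|x|<1\}$. Let $G_\rho(x,y)$ be the Green function of $-\Delta$ on $\Omega_\rho$ under Dirichlet boundary conditions, let $$H_\rho(x,y)=\frac{1}{\omega_{N-1}(N-2)|x-y|^{N-2}}-G_\rho(x,y)$$ be its regular part (extended harmonically across $x=y$), where $\omega_{N-1}$ is the surface measure of the unit sphere of $\mathbb R^N$, and let $\tau_\rho(x)=H_\rho(x,x)$ be the Robin function. For $r\in(\rho,1)$ put $\xi_j(r)=(re^{2\pi\mathtt i(j-1)/k},\mathbf 0)\in\mathbb R^2\times\mathbb R^{N-2}$, $j=1,\dots,k$, and let $\Lambda_1(r)$ be the first (least) eigenvalue of the $k\times k$ matrix with diagonal entries $\tau_\rho(\xi_i(r))$ and off-diagonal entries $-G_\rho(\xi_i(r),\xi_j(r))$, $i\ne j$. Then the function $\Lambda_1$ is differentiable on $(\rho,1)$ and has exactly one critical point in $(\rho,1)$, and this critical point is a global minimum point of $\Lambda_1$ on $(\rho,1)$. -/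

import Mathlib

noncomputable section

namespace AnnulusGreen

/-- The surface measure `ω_{N-1}` of the unit sphere of `ℝ^N`. -/
def sphereArea (N : ℕ) : ℝ :=
  (MeasureTheory.volume : MeasureTheory.Measure (EuclideanSpace ℝ (Fin N))).toSphere.real Set.univ

/-- The fundamental solution `1 / (ω_{N-1} (N-2) |x-y|^{N-2})` of `-Δ` in `ℝ^N`
(used for `N ≥ 3` and `x ≠ y` only). -/
def fundamentalSolution {N : ℕ} (x y : EuclideanSpace ℝ (Fin N)) : ℝ :=
  1 / (sphereArea N * ((N : ℝ) - 2) * ‖x - y‖ ^ (N - 2))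

/-- `h` is the corrector of the open set `Ω` with pole `y`: the solution of the Dirichlet problem
`Δ h = 0` in `Ω`, `h = fundamentalSolution · y` on `∂Ω`, continuous up to the boundary.
Equivalently, `fundamentalSolution · y - h` solves `-Δ G = δ_y` in `Ω`, `G = 0` on `∂Ω`.
For bounded `Ω` and `y ∈ Ω` it is unique on the closure of `Ω` by the maximum principle. -/
structure IsCorrector {N : ℕ} (Ω : Set (EuclideanSpace ℝ (Fin N)))
    (y : EuclideanSpace ℝ (Fin N)) (h : EuclideanSpace ℝ (Fin N) → ℝ) : Prop where
  harmonic : InnerProductSpace.HarmonicOnNhd h Ω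
  continuousOn : ContinuousOn h (closure Ω)
  boundary : ∀ x ∈ frontier Ω, h x = fundamentalSolution x y

/-- The regular part `H(x, y)` of the Dirichlet Green function of `-Δ` on `Ω`: the value at `x` of
the corrector with pole `y`. (If no corrector exists, the value is meaningless.) -/
def regularPart {N : ℕ} (Ω : Set (EuclideanSpace ℝ (Fin N))) (x y : EuclideanSpace ℝ (Fin N)) :
    ℝ :=
  Classical.epsilon (IsCorrector Ω y) x

/-- The Green function `G(x, y)`, `x ≠ y`, of `-Δ` on `Ω` under Dirichlet boundary conditions. -/
def green {N : ℕ} (Ω : Set (EuclideanSpace ℝ (Fin N))) (x y : EuclideanSpace ℝ (Fin N)) : ℝ :=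
  fundamentalSolution x y - regularPart Ω x y

/-- The Robin function `τ(x) = H(x, x)`. -/
def robin {N : ℕ} (Ω : Set (EuclideanSpace ℝ (Fin N))) (x : EuclideanSpace ℝ (Fin N)) : ℝ :=
  regularPart Ω x x

/-- The matrix `M(ξ)` with diagonal entries `τ(ξ_i)` and off-diagonal entries `-G(ξ_i, ξ_j)`. -/
def greenMatrix {N k : ℕ} (Ω : Set (EuclideanSpace ℝ (Fin N)))
    (ξ : Fin k → EuclideanSpace ℝ (Fin N)) : Matrix (Fin k) (Fin k) ℝ :=
  Matrix.of fun i j => if i = j then robin Ω (ξ i) else -green Ω (ξ i) (ξ j)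

/-- The first, i.e. least, eigenvalue of a real square matrix. -/
def firstEigenvalue {k : ℕ} (M : Matrix (Fin k) (Fin k) ℝ) : ℝ :=
  sInf {μ : ℝ | Module.End.HasEigenvalue (Matrix.toLin' M) μ}

/-- The annulus `{x ∈ ℝ^N : ρ < |x| < 1}`. -/
def annulus (N : ℕ) (ρ : ℝ) : Set (EuclideanSpace ℝ (Fin N)) :=
  {x | ρ < ‖x‖ ∧ ‖x‖ < 1}

/-- The vertices `(r e^{2πij/k}, 0) ∈ ℝ² × ℝ^{N-2}`, `j = 0, …, k-1`, of the regular `k`-gon of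
radius `r` in the `(x₁, x₂)`-plane. -/
def polygonPoint (N k : ℕ) (r : ℝ) (j : Fin k) : EuclideanSpace ℝ (Fin N) :=
  WithLp.toLp 2 fun i : Fin N =>
    if (i : ℕ) = 0 then r * Real.cos (2 * Real.pi * (j : ℕ) / k)
    else if (i : ℕ) = 1 then r * Real.sin (2 * Real.pi * (j : ℕ) / k)
    else 0

/-- `Λ₁(r)`: the first eigenvalue of the matrix `M` at the vertices of the regular `k`-gon of
radius `r` in the annulus. -/
def Lambda1 (N k : ℕ) (ρ r : ℝ) : ℝ :=
  firstEigenvalue (greenMatrix (annulus N ρ) (polygonPoint N k r))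

end AnnulusGreen

end

set_option maxSynthPendingDepth 3

namespace AnnulusGreen

open Set Filter Topology InnerProductSpace

/-! ### Harmonicity of the Newton kernel and of superpositions of it. -/

section Harmonic

variable {E : Type*} [NormedAddCommGroup E] [InnerProductSpace ℝ E] [FiniteDimensional ℝ E]

/-! Write `N = n + 2`. Reflecting a unit charge at `y` repeatedly in the two boundary spheres gives
an explicit corrector of the annulus (`annulusImages`, `annulusImages_of_mem_sphere`). By the
maximum principle it is the regular part, and the Green function is nonnegative.

The matrix at the polygon therefore has nonpositive off-diagonal entries, and by rotational symmetry
its row sums are constant. Hence its least eigenvalue is the row sum, with the constant eigenvector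
(`firstEigenvalue_eq_of_sum_eq`). Summing the image series over the vertices gives (`Lambda1_eq`)
`Λ₁(r) = c (A(r²) - D r⁻ⁿ + ρⁿ r⁻²ⁿ A(ρ²/r²))`, with `c > 0`, where `A(z) = ∑ ρⁿˡ K(ρ²ˡ z)` and `K`
is the sum of the Gegenbauer generating functions over the vertex angles.

`K` has nonnegative Taylor coefficients: `(1 - 2z cos θ + z²)^(-n/2)` is `|(1 - z e^{iθ})^(-n/2)|²`,
the binomial coefficients involved are nonnegative, and summing the phases over the `k`-th roots of
unity gives `0` or `k`. So `A` is nondecreasing and convex on `[0, 1)`, and it is at least `1/(1 -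
z)`.

Finally `r^(n+1) Λ₁'(r) / c` is strictly increasing, negative somewhere near `ρ` and positive
somewhere near `1`, which yields the unique critical point and its minimality
(`unique_critical_point`). -/

theorem laplacian_eq_sum_of_hasFDerivAt {ι : Type*} [Fintype ι] {f : E → ℝ} {f' : E → E →L[ℝ] ℝ}
    {f'' : E →L[ℝ] E →L[ℝ] ℝ} {x : E} (hf : ∀ᶠ z in 𝓝 x, HasFDerivAt f (f' z) z)
    (hf' : HasFDerivAt f' f'' x) (v : OrthonormalBasis ι ℝ E) :
    Laplacian.laplacian f x = ∑ i, f'' (v i) (v i) := by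
  have h : fderiv ℝ f =ᶠ[𝓝 x] f' := hf.mono fun z hz => hz.fderiv
  rw [laplacian_eq_iteratedFDeriv_orthonormalBasis f v]
  simp [iteratedFDeriv_two_apply, h.fderiv_eq, hf'.fderiv]

/-- Two explicit derivatives, the second continuous, give `C²`; harmonicity then reduces to a
vanishing trace. -/
theorem harmonicOnNhd_of_hasFDerivAt {ι : Type*} [Fintype ι] {f : E → ℝ} {f' : E → E →L[ℝ] ℝ}
    {f'' : E → E →L[ℝ] E →L[ℝ] ℝ} {U : Set E} (hU : IsOpen U)
    (hf : ∀ x ∈ U, HasFDerivAt f (f' x) x) (hf' : ∀ x ∈ U, HasFDerivAt f' (f'' x) x)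
    (hc : ContinuousOn f'' U) (v : OrthonormalBasis ι ℝ E)
    (h0 : ∀ x ∈ U, ∑ i, f'' x (v i) (v i) = 0) : HarmonicOnNhd f U := by
  intro x hx
  have hUx : U ∈ 𝓝 x := hU.mem_nhds hx
  refine ⟨?_, ?_⟩
  · have h1 : ContDiffAt ℝ ((0 : ℕ) + 1) f' x :=
      contDiffAt_succ_iff_hasFDerivAt.2 ⟨f'', ⟨U, hUx, hf'⟩, by
        rw [Nat.cast_zero, contDiffAt_zero]
        exact ⟨U, hUx, hc⟩⟩
    have h2 : ContDiffAt ℝ ((1 : ℕ) + 1) f x :=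
      contDiffAt_succ_iff_hasFDerivAt.2 ⟨f', ⟨U, hUx, hf⟩, by simpa using h1⟩
    norm_num at h2
    exact h2
  · filter_upwards [hUx] with z hz
    rw [laplacian_eq_sum_of_hasFDerivAt (f' := f') _ (hf' z hz) v, h0 z hz, Pi.zero_apply]
    filter_upwards [hU.mem_nhds hz] with y hy using hf y hy

omit [FiniteDimensional ℝ E] in
/-- Termwise differentiation of a superposition of dilated translates of a `C¹` function. -/
theorem hasFDerivAt_tsum_comp_affine {F : Type*} [NormedAddCommGroup F] [NormedSpace ℝ F]
    [CompleteSpace F] {g : E → F} {V K U : Set E} (hV : IsOpen V) (hg : ContDiffOn ℝ 1 g V)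
    (hK : IsCompact K) (hKV : K ⊆ V) (hU : IsOpen U) {w b : ℕ → ℝ} {y : ℕ → E} (hw : Summable w)
    (hw0 : ∀ l, 0 ≤ w l) (hb0 : ∀ l, 0 ≤ b l) (hb1 : ∀ l, b l ≤ 1)
    (hm : ∀ x ∈ U, ∀ l, b l • x - y l ∈ K) :
    (∀ x ∈ U, HasFDerivAt (fun x => ∑' l, w l • g (b l • x - y l))
      (∑' l, (w l * b l) • fderiv ℝ g (b l • x - y l)) x) ∧
    (∀ x ∈ U, Summable fun l => (w l * b l) • fderiv ℝ g (b l • x - y l)) ∧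
    ContinuousOn (fun x => ∑' l, (w l * b l) • fderiv ℝ g (b l • x - y l)) U := by
  have hg1 : ∀ v ∈ V, HasFDerivAt g (fderiv ℝ g v) v := fun v hv =>
    ((hg.contDiffAt (hV.mem_nhds hv)).differentiableAt (by norm_num)).hasFDerivAt
  have hg' : ContinuousOn (fderiv ℝ g) V := hg.continuousOn_fderiv_of_isOpen hV le_rfl
  obtain ⟨C0, hC0⟩ := hK.exists_bound_of_continuousOn (hg.continuousOn.mono hKV)
  obtain ⟨C1, hC1⟩ := hK.exists_bound_of_continuousOn (hg'.mono hKV)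
  have h1 : ∀ l, ∀ x ∈ U, HasFDerivAt (fun x => w l • g (b l • x - y l))
      ((w l * b l) • fderiv ℝ g (b l • x - y l)) x := fun l x hx => by
    have haff : HasFDerivAt (fun x => b l • x - y l) (b l • ContinuousLinearMap.id ℝ E) x :=
      ((hasFDerivAt_id x).const_smul (b l)).sub_const _
    refine (((hg1 _ (hKV (hm x hx l))).comp x haff).const_smul (w l)).congr_fderiv ?_
    ext u
    simp [mul_smul]
  have hb1' : ∀ l, ∀ x ∈ U, ‖(w l * b l) • fderiv ℝ g (b l • x - y l)‖ ≤ w l * C1 :=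
    fun l x hx => by
      rw [norm_smul, Real.norm_of_nonneg (mul_nonneg (hw0 l) (hb0 l))]
      exact mul_le_mul (mul_le_of_le_one_right (hw0 l) (hb1 l)) (hC1 _ (hm x hx l))
        (norm_nonneg _) (hw0 l)
  have hs0 : ∀ x ∈ U, Summable fun l => w l • g (b l • x - y l) := fun x hx =>
    Summable.of_norm_bounded (hw.mul_right C0) fun l => by
      rw [norm_smul, Real.norm_of_nonneg (hw0 l)]
      exact mul_le_mul_of_nonneg_left (hC0 _ (hm x hx l)) (hw0 l)
  refine ⟨fun x hx => ?_, fun x hx =>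
    Summable.of_norm_bounded (hw.mul_right C1) fun l => hb1' l x hx, ?_⟩
  · obtain ⟨r, hr, hrU⟩ := Metric.isOpen_iff.1 hU x hx
    exact hasFDerivAt_tsum_of_isPreconnected (hw.mul_right C1) Metric.isOpen_ball
      (convex_ball x r).isPreconnected (fun l z hz => h1 l z (hrU hz))
      (fun l z hz => hb1' l z (hrU hz)) (Metric.mem_ball_self hr) (hs0 x hx)
      (Metric.mem_ball_self hr)
  · refine continuousOn_tsum (fun l => ?_) (hw.mul_right C1) fun l x hx => hb1' l x hx
    have haff : ContinuousOn (fun x => b l • x - y l) U := by fun_prop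
    exact (hg'.comp haff fun x hx => hKV (hm x hx l)).const_smul (w l * b l)

/-- A superposition of dilated translates of a harmonic function is harmonic. -/
theorem harmonicOnNhd_tsum_comp_affine {p : E → ℝ} {V K U : Set E} (hV : IsOpen V)
    (hp : HarmonicOnNhd p V) (hK : IsCompact K) (hKV : K ⊆ V) (hU : IsOpen U)
    {w b : ℕ → ℝ} {y : ℕ → E} (hw : Summable w) (hw0 : ∀ l, 0 ≤ w l)
    (hb0 : ∀ l, 0 ≤ b l) (hb1 : ∀ l, b l ≤ 1) (hm : ∀ x ∈ U, ∀ l, b l • x - y l ∈ K) :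
    HarmonicOnNhd (fun x => ∑' l, w l * p (b l • x - y l)) U := by
  have hp1 : ∀ v ∈ V, HasFDerivAt p (fderiv ℝ p v) v := fun v hv =>
    ((hp v hv).1.differentiableAt (by norm_num)).hasFDerivAt
  have hcd : ContDiffOn ℝ 1 (fderiv ℝ p) V :=
    ((contDiffOn_succ_iff_fderiv_of_isOpen (n := 1) hV).1 (by
      have := hp.contDiffOn
      norm_num
      exact this)).2.2
  have hp2 : ∀ v ∈ V, HasFDerivAt (fderiv ℝ p) (fderiv ℝ (fderiv ℝ p) v) v := fun v hv =>
    ((hcd.contDiffAt (hV.mem_nhds hv)).differentiableAt (by norm_num)).hasFDerivAt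
  have hwb : ∀ l, 0 ≤ w l * b l := fun l => mul_nonneg (hw0 l) (hb0 l)
  obtain ⟨h1, -, -⟩ := hasFDerivAt_tsum_comp_affine hV (hp.contDiffOn.of_le (by norm_num)) hK hKV
    hU hw hw0 hb0 hb1 hm
  -- The first derivative is again such a series, for `fderiv ℝ p` with weights `w l * b l`, still
  -- summable because `b l ≤ 1`.
  obtain ⟨h2, hs2, hc⟩ := hasFDerivAt_tsum_comp_affine hV hcd hK hKV hU
    (Summable.of_nonneg_of_le hwb (fun l => mul_le_of_le_one_right (hw0 l) (hb1 l)) hw)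
    hwb hb0 hb1 hm
  refine harmonicOnNhd_of_hasFDerivAt hU h1 h2 hc (stdOrthonormalBasis ℝ E) fun x hx => ?_
  have hz : ∀ l, ∑ i, fderiv ℝ (fderiv ℝ p) (b l • x - y l) (stdOrthonormalBasis ℝ E i)
      (stdOrthonormalBasis ℝ E i) = 0 := fun l => by
    have hv := hKV (hm x hx l)
    rw [← laplacian_eq_sum_of_hasFDerivAt (f := p) _ (hp2 _ hv)]
    · exact (hp _ hv).2.self_of_nhds
    · filter_upwards [hV.mem_nhds hv] with z hz using hp1 z hz
  have hs : ∀ u : E, HasSum (fun l => w l * b l * b l * fderiv ℝ (fderiv ℝ p) (b l • x - y l) u u)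
      ((∑' l, (w l * b l * b l) • fderiv ℝ (fderiv ℝ p) (b l • x - y l)) u u) := fun u => by
    have := ((hs2 x hx).hasSum.mapL (ContinuousLinearMap.apply ℝ (E →L[ℝ] ℝ) u)).mapL
      (ContinuousLinearMap.apply ℝ ℝ u)
    simpa using this
  refine HasSum.unique (hasSum_sum fun i _ => hs _) ?_
  simp_rw [← Finset.mul_sum, hz, mul_zero]
  exact hasSum_zero

/-- The Newton kernel `‖v‖^(-n)` is harmonic off the origin in dimension `n + 2`. -/
theorem harmonicOnNhd_newton {n : ℕ} (hE : Module.finrank ℝ E = n + 2) :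
    HarmonicOnNhd (fun v : E => (‖v‖ ^ n)⁻¹) {0}ᶜ := by
  have hpow : (fun v : E => (‖v‖ ^ n)⁻¹) = fun v => (‖v‖ ^ 2) ^ (-(n / 2) : ℝ) := by
    ext v
    rw [← Real.rpow_natCast, ← Real.rpow_natCast, ← Real.rpow_mul (norm_nonneg v),
      ← Real.rpow_neg (norm_nonneg v)]
    congr 1
    push_cast
    ring
  rw [hpow]
  set a : ℝ := -(n / 2) with ha
  obtain ⟨J, hJ⟩ : ∃ J : E →L[ℝ] E →L[ℝ] ℝ, ∀ u v, J u v = inner ℝ u v :=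
    ⟨innerSL ℝ, fun u v => innerSL_apply_apply ℝ u v⟩
  have hsq : ∀ v : E, HasFDerivAt (fun x : E => ‖x‖ ^ 2) ((2 : ℝ) • J v) v := fun v => by
    refine (hasStrictFDerivAt_norm_sq v).hasFDerivAt.congr_fderiv ?_
    ext u
    simp [hJ, two_smul]
  have hne : ∀ v ∈ ({0}ᶜ : Set E), ‖v‖ ^ 2 ≠ 0 := fun v hv => by simpa using hv
  refine harmonicOnNhd_of_hasFDerivAt isOpen_compl_singleton
    (f' := fun v => (a * (‖v‖ ^ 2) ^ (a - 1)) • ((2 : ℝ) • J v))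
    (f'' := fun v => (a * (‖v‖ ^ 2) ^ (a - 1)) • ((2 : ℝ) • J) +
      (a • ((a - 1) * (‖v‖ ^ 2) ^ (a - 1 - 1)) • ((2 : ℝ) • J v)).smulRight ((2 : ℝ) • J v))
    ?_ ?_ ?_ (stdOrthonormalBasis ℝ E) ?_
  · intro v hv
    exact (hsq v).rpow_const (Or.inl (hne v hv))
  · intro v hv
    have h1 := ((hsq v).rpow_const (p := a - 1) (Or.inl (hne v hv))).const_mul a
    have h2 : HasFDerivAt (fun v : E => (2 : ℝ) • J v) ((2 : ℝ) • J) v := by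
      exact ((2 : ℝ) • J).hasFDerivAt (x := v)
    exact h1.smul h2
  · have hr : ∀ t : ℝ, ContinuousOn (fun v : E => (‖v‖ ^ 2) ^ t) {0}ᶜ := fun t =>
      ContinuousOn.rpow_const (by fun_prop) fun v hv => Or.inl (hne v hv)
    have h1 : ContinuousOn (fun v : E => (a * (‖v‖ ^ 2) ^ (a - 1)) • ((2 : ℝ) • J)) {0}ᶜ :=
      (continuousOn_const.mul (hr _)).smul continuousOn_const
    have h2 : ContinuousOn (fun v : E => (2 : ℝ) • J v) {0}ᶜ :=
      (J.continuous.const_smul (2 : ℝ)).continuousOn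
    have h3 : ContinuousOn (fun v : E => a • ((a - 1) * (‖v‖ ^ 2) ^ (a - 1 - 1)) • (2 : ℝ) • J v)
        {0}ᶜ := by
      have hs : ContinuousOn (fun v : E => (a - 1) * (‖v‖ ^ 2) ^ (a - 1 - 1)) {0}ᶜ :=
        continuousOn_const.mul (hr _)
      exact (hs.smul h2).const_smul a
    exact h1.add ((ContinuousLinearMap.smulRightL ℝ E (E →L[ℝ] ℝ)).continuous₂.comp_continuousOn
      (h3.prodMk h2))
  · intro v hv
    -- By Parseval the trace is a multiple of `2a(n + 2) + 4a(a - 1) = 2a(n + 2a)`, which vanishes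
    -- for `a = -n/2`.
    have hpar : ∑ i, inner ℝ v (stdOrthonormalBasis ℝ E i) * inner ℝ v (stdOrthonormalBasis ℝ E i)
        = ‖v‖ ^ 2 := by
      have := (stdOrthonormalBasis ℝ E).sum_sq_norm_inner_left v
      rw [← this]
      refine Finset.sum_congr rfl fun i _ => ?_
      rw [Real.norm_eq_abs, sq_abs, sq]
    have hq : (‖v‖ ^ 2) ^ (a - 1) = (‖v‖ ^ 2) ^ (a - 1 - 1) * ‖v‖ ^ 2 := by
      rw [← Real.rpow_add_one (hne v hv)]
      congr 1
      ring
    have e : ∀ i, ((a * (‖v‖ ^ 2) ^ (a - 1)) • ((2 : ℝ) • J) +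
      (a • ((a - 1) * (‖v‖ ^ 2) ^ (a - 1 - 1)) • ((2 : ℝ) • J v)).smulRight ((2 : ℝ) • J v) :
        E →L[ℝ] E →L[ℝ] ℝ)
        (stdOrthonormalBasis ℝ E i) (stdOrthonormalBasis ℝ E i) =
      2 * a * (‖v‖ ^ 2) ^ (a - 1) + 4 * a * (a - 1) * (‖v‖ ^ 2) ^ (a - 1 - 1) *
        (inner ℝ v (stdOrthonormalBasis ℝ E i) * inner ℝ v (stdOrthonormalBasis ℝ E i)) := by
      intro i
      simp [hJ]
      ring
    simp_rw [e]
    rw [Finset.sum_add_distrib, ← Finset.mul_sum _ _ (4 * a * (a - 1) * (‖v‖ ^ 2) ^ (a - 1 - 1)), hpar, hq]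
    simp [hE, ha]
    ring

end Harmonic

/-! ### The weak maximum principle. -/

section MaximumPrinciple

variable {E : Type*} [NormedAddCommGroup E] [InnerProductSpace ℝ E] [FiniteDimensional ℝ E]

-- Restrict to the line `z + t e`: a positive second derivative would make the maximum also a local
-- minimum, so the restriction would be locally constant, a contradiction.
omit [FiniteDimensional ℝ E] in
theorem iteratedFDeriv_two_nonpos_of_isLocalMax {f : E → ℝ} {z : E} (hf : ContDiffAt ℝ 2 f z)
    (hz : IsLocalMax f z) (e : E) : iteratedFDeriv ℝ 2 f z ![e, e] ≤ 0 := by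
  have hev : ∀ᶠ x in 𝓝 z, HasFDerivAt f (fderiv ℝ f x) x := by
    filter_upwards [hf.eventually (by simp)] with x hx
    exact (hx.differentiableAt (by norm_num)).hasFDerivAt
  have hf2 : HasFDerivAt (fderiv ℝ f) (fderiv ℝ (fderiv ℝ f) z) z :=
    ((hf.fderiv_right (m := 1) (by norm_num)).differentiableAt (by norm_num)).hasFDerivAt
  have hline : ∀ t : ℝ, HasDerivAt (fun t : ℝ => z + t • e) e t := fun t => by
    simpa using ((hasDerivAt_id t).smul_const e).const_add z
  have hcont : Tendsto (fun t : ℝ => z + t • e) (𝓝 0) (𝓝 z) := by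
    have : ContinuousAt (fun t : ℝ => z + t • e) 0 := (hline 0).continuousAt
    simpa [ContinuousAt] using this
  set g : ℝ → ℝ := fun t => f (z + t • e) with hg
  have hg1 : deriv g =ᶠ[𝓝 0] fun t => fderiv ℝ f (z + t • e) e := by
    filter_upwards [hcont.eventually hev] with t ht
    exact (ht.comp_hasDerivAt t (hline t)).deriv
  have hg2 : deriv (deriv g) 0 = fderiv ℝ (fderiv ℝ f) z e e := by
    rw [hg1.deriv_eq]
    have h1 : HasDerivAt (fun t : ℝ => fderiv ℝ f (z + t • e)) (fderiv ℝ (fderiv ℝ f) z e) 0 := by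
      refine HasFDerivAt.comp_hasDerivAt (0 : ℝ) ?_ (hline 0)
      simpa using hf2
    simpa using (h1.clm_apply (hasDerivAt_const (0 : ℝ) e)).deriv
  have hmax : IsLocalMax g 0 := by
    have : ∀ᶠ t in 𝓝 (0 : ℝ), f (z + t • e) ≤ f z := hcont.eventually hz
    filter_upwards [this] with t ht
    simpa [hg] using ht
  rw [iteratedFDeriv_two_apply]
  simp only [Matrix.cons_val_zero, Matrix.cons_val_one]
  rw [← hg2]
  by_contra! hpos
  have hgc : ContinuousAt g 0 := by
    refine ContinuousAt.comp (f := fun t : ℝ => z + t • e) ?_ (hline 0).continuousAt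
    simpa using hf.continuousAt
  have hmin := isLocalMin_of_deriv_deriv_pos hpos hmax.deriv_eq_zero hgc
  have hconst : g =ᶠ[𝓝 0] fun _ => g 0 := by
    filter_upwards [hmax, hmin] with t h1 h2 using le_antisymm h1 h2
  have h0 : deriv g =ᶠ[𝓝 0] deriv fun _ => g 0 := hconst.deriv
  rw [h0.deriv_eq] at hpos
  simp at hpos

theorem laplacian_norm_sq (x : E) :
    Laplacian.laplacian (fun x : E => ‖x‖ ^ 2) x = 2 * Module.finrank ℝ E := by
  rw [laplacian_eq_sum_of_hasFDerivAt (f' := fun v => (2 : ℝ) • innerSL ℝ v)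
    (f'' := (2 : ℝ) • (innerSL ℝ : E →L[ℝ] E →L[ℝ] ℝ)) _ _ (stdOrthonormalBasis ℝ E)]
  · have hi : ∀ i, innerSL ℝ (stdOrthonormalBasis ℝ E i) (stdOrthonormalBasis ℝ E i) = (1 : ℝ) :=
      fun i => by rw [innerSL_apply_apply]; simp
    simp [hi, mul_comm]
  · refine Eventually.of_forall fun v => ?_
    refine (hasStrictFDerivAt_norm_sq v).hasFDerivAt.congr_fderiv ?_
    ext u
    simp [two_smul]
  · exact ((2 : ℝ) • (innerSL ℝ : E →L[ℝ] E →L[ℝ] ℝ)).hasFDerivAt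

/-- The weak maximum principle for harmonic functions on bounded open sets. -/
theorem nonpos_of_harmonicOnNhd [Nontrivial E] {Ω : Set E} {u : E → ℝ} (hΩ : IsOpen Ω)
    (hb : Bornology.IsBounded Ω) (hu : HarmonicOnNhd u Ω) (hc : ContinuousOn u (closure Ω))
    (h0 : ∀ x ∈ frontier Ω, u x ≤ 0) {x : E} (hx : x ∈ Ω) : u x ≤ 0 := by
  by_contra! hpos
  obtain ⟨R, hR⟩ := hb.closure.exists_norm_le
  have hR0 : 0 ≤ R := (norm_nonneg x).trans (hR x (subset_closure hx))
  obtain ⟨ε, hε, hεR⟩ : ∃ ε > 0, ε * R ^ 2 < u x := by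
    refine ⟨u x / (2 * (R ^ 2 + 1)), by positivity, ?_⟩
    rw [div_mul_eq_mul_div, div_lt_iff₀ (by positivity)]
    nlinarith [sq_nonneg R]
  have hsq : ∀ z ∈ closure Ω, ‖z‖ ^ 2 ≤ R ^ 2 := fun z hz =>
    pow_le_pow_left₀ (norm_nonneg z) (hR z hz) 2
  -- Adding `ε‖z‖²` makes the Laplacian strictly positive, and `ε R² < u x` keeps the maximum off
  -- the boundary.
  set q : E → ℝ := fun z => ‖z‖ ^ 2
  have hq : ContDiff ℝ 2 q := contDiff_norm_sq ℝ
  obtain ⟨z, hz, hzmax⟩ := hb.isCompact_closure.exists_isMaxOn ⟨x, subset_closure hx⟩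
    (f := u + ε • q) (hc.add ((hq.continuous.const_smul ε).continuousOn))
  have hxz : u x + ε * ‖x‖ ^ 2 ≤ u z + ε * ‖z‖ ^ 2 := hzmax (subset_closure hx)
  have hzΩ : z ∈ Ω := by
    by_contra hzn
    have h1 := h0 z ⟨hz, by rwa [hΩ.interior_eq]⟩
    have h2 := mul_le_mul_of_nonneg_left (hsq z hz) hε.le
    nlinarith [mul_nonneg hε.le (sq_nonneg ‖x‖)]
  have hcd : ContDiffAt ℝ 2 (ε • q) z := hq.contDiffAt.const_smul ε
  have hloc : IsLocalMax (u + ε • q) z :=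
    hzmax.isLocalMax (mem_of_superset (hΩ.mem_nhds hzΩ) subset_closure)
  have hle : Laplacian.laplacian (u + ε • q) z ≤ 0 := by
    rw [laplacian_eq_iteratedFDeriv_stdOrthonormalBasis]
    exact Finset.sum_nonpos fun i _ =>
      iteratedFDeriv_two_nonpos_of_isLocalMax ((hu z hzΩ).1.add hcd) hloc _
  rw [(hu z hzΩ).1.laplacian_add hcd, laplacian_smul ε hq.contDiffAt, laplacian_norm_sq,
    (hu z hzΩ).2.self_of_nhds] at hle
  have hfin : (0 : ℝ) < Module.finrank ℝ E := by exact_mod_cast Module.finrank_pos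
  simp only [Pi.zero_apply, zero_add, smul_eq_mul] at hle
  nlinarith [mul_pos hε hfin]

theorem harmonicOnNhd_comp_sub_right {f : E → ℝ} {s : Set E} (hf : HarmonicOnNhd f s) (y : E) :
    HarmonicOnNhd (fun x => f (x - y)) {x | x - y ∈ s} := by
  intro x hx
  have ht : Tendsto (fun x => x - y) (𝓝 x) (𝓝 (x - y)) := by
    have : Continuous fun x : E => x - y := by fun_prop
    exact this.tendsto x
  refine ⟨ContDiffAt.comp x (hf _ hx).1 (by fun_prop), ?_⟩
  filter_upwards [ht.eventually (hf _ hx).2] with z hz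
  rw [laplacian_eq_iteratedFDeriv_stdOrthonormalBasis] at hz ⊢
  simpa [iteratedFDeriv_comp_sub] using hz

end MaximumPrinciple

/-! ### Uniqueness of the corrector and positivity of the Green function. -/

section Corrector

variable {N : ℕ}

theorem IsCorrector.eqOn {Ω : Set (EuclideanSpace ℝ (Fin N))} {y : EuclideanSpace ℝ (Fin N)}
    {h₁ h₂ : EuclideanSpace ℝ (Fin N) → ℝ} (hN : 0 < N) (hΩ : IsOpen Ω)
    (hb : Bornology.IsBounded Ω) (H₁ : IsCorrector Ω y h₁) (H₂ : IsCorrector Ω y h₂) :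
    EqOn h₁ h₂ Ω := by
  have : Nonempty (Fin N) := ⟨⟨0, hN⟩⟩
  intro x hx
  refine le_antisymm ?_ ?_
  · have := nonpos_of_harmonicOnNhd hΩ hb (H₁.harmonic.sub H₂.harmonic)
      (H₁.continuousOn.sub H₂.continuousOn)
      (fun z hz => by simp [H₁.boundary z hz, H₂.boundary z hz]) hx
    simpa using this
  · have := nonpos_of_harmonicOnNhd hΩ hb (H₂.harmonic.sub H₁.harmonic)
      (H₂.continuousOn.sub H₁.continuousOn)
      (fun z hz => by simp [H₁.boundary z hz, H₂.boundary z hz]) hx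
    simpa using this

/-- Uniqueness makes the choice in `Classical.epsilon` harmless: exhibiting any corrector computes
the regular part. -/
theorem regularPart_eq {Ω : Set (EuclideanSpace ℝ (Fin N))} {x y : EuclideanSpace ℝ (Fin N)}
    {h : EuclideanSpace ℝ (Fin N) → ℝ} (hN : 0 < N) (hΩ : IsOpen Ω)
    (hb : Bornology.IsBounded Ω) (H : IsCorrector Ω y h) (hx : x ∈ Ω) :
    regularPart Ω x y = h x :=
  (Classical.epsilon_spec (p := IsCorrector Ω y) ⟨h, H⟩).eqOn hN hΩ hb H hx

theorem sphereArea_pos (hN : 0 < N) : 0 < sphereArea N := by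
  have : Nonempty (Fin N) := ⟨⟨0, hN⟩⟩
  rw [sphereArea, MeasureTheory.Measure.toSphere_real_apply_univ]
  refine mul_pos (by exact_mod_cast Module.finrank_pos) ?_
  exact ENNReal.toReal_pos (Metric.measure_ball_pos _ _ one_pos).ne' MeasureTheory.measure_ball_lt_top.ne

/-- The normalising constant `1 / (ω_{n+1} n)` of the fundamental solution in `ℝ^(n+2)`. -/
noncomputable def newtonConst (n : ℕ) : ℝ := 1 / (sphereArea (n + 2) * n)

theorem newtonConst_pos {n : ℕ} (hn : 1 ≤ n) : 0 < newtonConst n := by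
  have h1 := sphereArea_pos (N := n + 2) (by omega)
  have h2 : (0 : ℝ) < n := by exact_mod_cast hn
  unfold newtonConst
  positivity

theorem fundamentalSolution_eq {n : ℕ} (x y : EuclideanSpace ℝ (Fin (n + 2))) :
    fundamentalSolution x y = newtonConst n * (‖x - y‖ ^ n)⁻¹ := by
  simp [fundamentalSolution, newtonConst, mul_comm]

/-- The Green function is nonnegative. -/
theorem IsCorrector.le_fundamentalSolution {n : ℕ} (hn : 1 ≤ n)
    {Ω : Set (EuclideanSpace ℝ (Fin (n + 2)))} {x y : EuclideanSpace ℝ (Fin (n + 2))}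
    {h : EuclideanSpace ℝ (Fin (n + 2)) → ℝ} (hΩ : IsOpen Ω)
    (hb : Bornology.IsBounded Ω) (H : IsCorrector Ω y h) (hx : x ∈ Ω) (hxy : x ≠ y) :
    h x ≤ fundamentalSolution x y := by
  have hc := newtonConst_pos hn
  obtain ⟨M, hM⟩ := hb.isCompact_closure.exists_bound_of_continuousOn H.continuousOn
  have hxy' : 0 < ‖x - y‖ := norm_pos_iff.2 (sub_ne_zero.2 hxy)
  -- On the sphere of radius `ε` about `y` the fundamental solution exceeds the bound `M` of `h`, so
  -- the maximum principle applies to the difference outside that ball.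
  obtain ⟨ε, hεM, hεx, hε⟩ : ∃ ε : ℝ, M * ε ^ n < newtonConst n ∧ ε < ‖x - y‖ ∧ 0 < ε := by
    have h1 : Tendsto (fun ε : ℝ => M * ε ^ n) (𝓝[>] 0) (𝓝 0) := by
      have : Continuous fun ε : ℝ => M * ε ^ n := by fun_prop
      have h := (this.tendsto 0).mono_left (nhdsWithin_le_nhds (s := Ioi 0))
      simpa [zero_pow (show n ≠ 0 by omega)] using h
    have h2 : ∀ᶠ ε : ℝ in 𝓝[>] 0, ε < ‖x - y‖ :=
      nhdsWithin_le_nhds (Iio_mem_nhds hxy')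
    have h3 : ∀ᶠ ε : ℝ in 𝓝[>] 0, 0 < ε := self_mem_nhdsWithin
    exact ((h1.eventually (Iio_mem_nhds hc)).and (h2.and h3)).exists
  set Ω' := Ω ∩ {z | ε < ‖z - y‖} with hΩ'
  have hopen : IsOpen Ω' := hΩ.inter (isOpen_lt continuous_const (by fun_prop))
  have hcl : closure Ω' ⊆ closure Ω ∩ {z | ε ≤ ‖z - y‖} := by
    refine closure_minimal (fun z hz => ⟨subset_closure hz.1, le_of_lt (show ε < ‖z - y‖ from hz.2)⟩) ?_
    exact isClosed_closure.inter (isClosed_le continuous_const (by fun_prop))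
  set F : EuclideanSpace ℝ (Fin (n + 2)) → ℝ := newtonConst n • fun z => (‖z - y‖ ^ n)⁻¹ with hF
  have hFh : HarmonicOnNhd F {z | z - y ∈ ({0}ᶜ : Set _)} :=
    (harmonicOnNhd_comp_sub_right (harmonicOnNhd_newton finrank_euclideanSpace_fin) y).const_smul
  have hmem : ∀ z ∈ closure Ω', z - y ∈ ({0}ᶜ : Set _) := fun z hz =>
    norm_pos_iff.1 (hε.trans_le (hcl hz).2)
  have key := nonpos_of_harmonicOnNhd hopen (hb.subset inter_subset_left) (u := h - F)
    ((H.harmonic.mono inter_subset_left).sub (hFh.mono fun z hz => hmem z (subset_closure hz)))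
    ((H.continuousOn.mono fun z hz => (hcl hz).1).sub (hFh.continuousOn.mono hmem))
    (fun z hz => ?_) (x := x) ⟨hx, hεx⟩
  · rw [fundamentalSolution_eq]
    simpa [hF] using key
  · rw [Pi.sub_apply, sub_nonpos]
    have hzc := hcl hz.1
    by_cases hzΩ : z ∈ Ω
    · have hzε : ‖z - y‖ = ε := by
        refine le_antisymm (not_lt.1 fun hlt => hz.2 ?_) hzc.2
        rw [hopen.interior_eq]
        exact ⟨hzΩ, hlt⟩
      refine ((le_abs_self _).trans (hM z hzc.1)).trans ?_
      simp only [hF, Pi.smul_apply, smul_eq_mul, hzε]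
      rw [← div_eq_mul_inv, le_div_iff₀ (by positivity)]
      exact hεM.le
    · rw [H.boundary z ⟨hzc.1, by rwa [hΩ.interior_eq]⟩, fundamentalSolution_eq]
      simp [hF]

end Corrector

/-! ### The method of images in a spherical shell. -/

section Images

variable {E : Type*} [NormedAddCommGroup E] [InnerProductSpace ℝ E]

/-- The potential of the point charges `w l` placed at the points `y l / b l`, up to scaling. -/
noncomputable def imageSum (n : ℕ) (w b : ℕ → ℝ) (y : ℕ → E) (x : E) : ℝ :=
  ∑' l, w l * (‖b l • x - y l‖ ^ n)⁻¹

theorem summable_imageSum {n : ℕ} {w b : ℕ → ℝ} {y : ℕ → E} {x : E} {d : ℝ} (hw : Summable w)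
    (hw0 : ∀ l, 0 ≤ w l) (hd : 0 < d) (hm : ∀ l, d ≤ ‖b l • x - y l‖) :
    Summable fun l => w l * (‖b l • x - y l‖ ^ n)⁻¹ :=
  Summable.of_nonneg_of_le (fun l => mul_nonneg (hw0 l) (by positivity))
    (fun l => mul_le_mul_of_nonneg_left
      (inv_anti₀ (by positivity) (pow_le_pow_left₀ hd.le (hm l) n)) (hw0 l))
    (hw.mul_right (d ^ n)⁻¹)

theorem harmonicOnNhd_imageSum [FiniteDimensional ℝ E] {n : ℕ}
    (hE : Module.finrank ℝ E = n + 2) {U : Set E} (hU : IsOpen U) {w b : ℕ → ℝ} {y : ℕ → E}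
    {d β : ℝ} (hw : Summable w) (hw0 : ∀ l, 0 ≤ w l) (hb0 : ∀ l, 0 ≤ b l) (hb1 : ∀ l, b l ≤ 1)
    (hy : ∀ l, ‖y l‖ ≤ 1) (hd : 0 < d) (hβ : ∀ x ∈ U, ‖x‖ ≤ β)
    (hm : ∀ x ∈ U, ∀ l, d ≤ ‖b l • x - y l‖) : HarmonicOnNhd (imageSum n w b y) U := by
  refine harmonicOnNhd_tsum_comp_affine (K := Metric.closedBall 0 (β + 1) ∩ {v | d ≤ ‖v‖})
    isOpen_compl_singleton (harmonicOnNhd_newton hE)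
    ((isCompact_closedBall _ _).inter_right (isClosed_le continuous_const continuous_norm))
    (fun v hv => norm_pos_iff.1 (hd.trans_le hv.2)) hU hw hw0 hb0 hb1 fun x hx l => ⟨?_, hm x hx l⟩
  rw [mem_closedBall_zero_iff]
  refine (norm_sub_le _ _).trans (add_le_add ?_ (hy l))
  rw [norm_smul, Real.norm_of_nonneg (hb0 l)]
  exact (mul_le_of_le_one_left (norm_nonneg x) (hb1 l)).trans (hβ x hx)

theorem norm_smul_sub_smul_sq (a b : ℝ) (x y : E) :
    ‖a • x - b • y‖ ^ 2 = a ^ 2 * ‖x‖ ^ 2 - 2 * (a * b) * inner ℝ x y + b ^ 2 * ‖y‖ ^ 2 := by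
  rw [norm_sub_sq_real, norm_smul, norm_smul, real_inner_smul_left, real_inner_smul_right,
    mul_pow, mul_pow, Real.norm_eq_abs, Real.norm_eq_abs, sq_abs, sq_abs]
  ring

/-- The potential of the images, in the two boundary spheres of the annulus, of a unit charge
placed at `y`. -/
noncomputable def annulusImages (n : ℕ) (ρ : ℝ) (y x : E) : ℝ :=
  imageSum n (fun l => (ρ ^ n) ^ l) (fun l => ‖y‖ * (ρ ^ 2) ^ l) (fun _ => ‖y‖⁻¹ • y) x
  - imageSum n (fun l => (ρ ^ n) ^ (l + 1)) (fun l => (ρ ^ 2) ^ (l + 1)) (fun _ => (1 : ℝ) • y) x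
  + imageSum n (fun l => (ρ ^ n) ^ (l + 1)) (fun _ => ‖y‖)
      (fun l => ((ρ ^ 2) ^ (l + 1) * ‖y‖⁻¹) • y) x
  - imageSum n (fun l => (ρ ^ n) ^ (l + 1)) (fun _ => 1) (fun l => (ρ ^ 2) ^ (l + 1) • y) x

/-- The outermost inner image has radius `ρ²/‖y‖ < ρ` and the innermost outer one `1/‖y‖ > 1`. Radii
`α`, `β` strictly in between bound an open shell `U` containing the closed one; the four gaps at `l
= 0` are the worst. -/
theorem exists_image_bound {ρ : ℝ} (hρ : ρ ∈ Ioo (0 : ℝ) 1) {y : E} (h₁ : ρ < ‖y‖)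
    (h₂ : ‖y‖ < 1) :
    ∃ U : Set E, IsOpen U ∧ {x | ρ ≤ ‖x‖ ∧ ‖x‖ ≤ 1} ⊆ U ∧ ∃ d > 0, ∃ β, ∀ x ∈ U, ‖x‖ ≤ β ∧
      ∀ l : ℕ, d ≤ ‖(‖y‖ * (ρ ^ 2) ^ l) • x - ‖y‖⁻¹ • y‖ ∧
        d ≤ ‖(ρ ^ 2) ^ (l + 1) • x - (1 : ℝ) • y‖ ∧
        d ≤ ‖‖y‖ • x - ((ρ ^ 2) ^ (l + 1) * ‖y‖⁻¹) • y‖ ∧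
        d ≤ ‖(1 : ℝ) • x - (ρ ^ 2) ^ (l + 1) • y‖ := by
  obtain ⟨hρ0, hρ1⟩ := hρ
  set s := ‖y‖ with hs
  have hs0 : 0 < s := hρ0.trans h₁
  obtain ⟨α, hα₁, hα₂⟩ : ∃ α, ρ ^ 2 / s < α ∧ α < ρ := exists_between (by
    rw [div_lt_iff₀ hs0]
    nlinarith)
  obtain ⟨β, hβ₁, hβ₂⟩ : ∃ β, 1 < β ∧ β < 1 / s := exists_between (by
    rwa [lt_div_iff₀ hs0, one_mul])
  rw [div_lt_iff₀ hs0] at hα₁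
  rw [lt_div_iff₀ hs0] at hβ₂
  have hα0 : 0 < α := by
    by_contra! h
    nlinarith [sq_nonneg ρ]
  set q := ρ ^ 2 with hq
  have hq0 : 0 < q := by positivity
  have hq1 : q ≤ 1 := by nlinarith
  have hqs : q < s * s := by nlinarith
  have d1 : 0 < 1 - β * s := by linarith
  have d2 : 0 < s - q * β := by
    nlinarith
  have d3 : 0 < α * s - q := by linarith
  have d4 : 0 < α - q * s := by nlinarith
  refine ⟨{x | α < ‖x‖ ∧ ‖x‖ < β}, ?_, ?_,
    min (min (1 - β * s) (s - q * β)) (min (α * s - q) (α - q * s)), ?_, β, ?_⟩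
  · exact (isOpen_lt continuous_const continuous_norm).inter
      (isOpen_lt continuous_norm continuous_const)
  · rintro x ⟨hx1, hx2⟩
    exact ⟨hα₂.trans_le hx1, hx2.trans_lt hβ₁⟩
  · exact lt_min (lt_min d1 d2) (lt_min d3 d4)
  · rintro x ⟨hx1, hx2⟩
    refine ⟨hx2.le, fun l => ?_⟩
    have hql : q ^ l ≤ 1 := pow_le_one₀ hq0.le hq1
    have hql0 : 0 < q ^ l := by positivity
    have hql' : q ^ (l + 1) ≤ q := by
      rw [pow_succ]
      nlinarith
    have hql0' : 0 < q ^ (l + 1) := by positivity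
    have hx0 := norm_nonneg x
    have hnorm : ∀ a b : ℝ, 0 ≤ a → 0 ≤ b →
        a * ‖x‖ - b * s ≤ ‖a • x - b • y‖ ∧ b * s - a * ‖x‖ ≤ ‖a • x - b • y‖ := by
      intro a b ha hb
      have e1 : ‖a • x‖ = a * ‖x‖ := by rw [norm_smul, Real.norm_of_nonneg ha]
      have e2 : ‖b • y‖ = b * s := by rw [norm_smul, Real.norm_of_nonneg hb]
      rw [← e1, ← e2]
      exact ⟨norm_sub_norm_le _ _, norm_sub_rev (a • x) (b • y) ▸ norm_sub_norm_le _ _⟩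
    have hss : s⁻¹ * s = 1 := inv_mul_cancel₀ hs0.ne'
    refine ⟨?_, ?_, ?_, ?_⟩
    · refine ((min_le_left _ _).trans (min_le_left _ _)).trans
        (le_trans ?_ (hnorm (s * q ^ l) s⁻¹ (by positivity) (by positivity)).2)
      rw [hss]
      have : s * q ^ l * ‖x‖ ≤ s * 1 * β := by gcongr
      linarith
    · refine ((min_le_left _ _).trans (min_le_right _ _)).trans
        (le_trans ?_ (hnorm (q ^ (l + 1)) 1 (by positivity) zero_le_one).2)
      have : q ^ (l + 1) * ‖x‖ ≤ q * β := by gcongr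
      linarith
    · refine ((min_le_right _ _).trans (min_le_left _ _)).trans
        (le_trans ?_ (hnorm s (q ^ (l + 1) * s⁻¹) (by positivity) (by positivity)).1)
      rw [mul_assoc, hss]
      have : s * α ≤ s * ‖x‖ := by gcongr
      linarith
    · refine ((min_le_right _ _).trans (min_le_right _ _)).trans
        (le_trans ?_ (hnorm 1 (q ^ (l + 1)) zero_le_one (by positivity)).1)
      have : q ^ (l + 1) * s ≤ q * s := by gcongr
      linarith

theorem summable_pow_pow {n : ℕ} (hn : 1 ≤ n) {ρ : ℝ} (hρ : ρ ∈ Ioo (0 : ℝ) 1) :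
    Summable fun l : ℕ => (ρ ^ n) ^ l :=
  summable_geometric_of_lt_one (pow_nonneg hρ.1.le n)
    (pow_lt_one₀ hρ.1.le hρ.2 (by omega))

/-- Including the closed shell in `U` provides continuity up to the boundary along with harmonicity
inside. -/
theorem exists_harmonicOnNhd_annulusImages [FiniteDimensional ℝ E] {n : ℕ} (hn : 1 ≤ n)
    (hE : Module.finrank ℝ E = n + 2) {ρ : ℝ} (hρ : ρ ∈ Ioo (0 : ℝ) 1) {y : E} (h₁ : ρ < ‖y‖)
    (h₂ : ‖y‖ < 1) : ∃ U : Set E, {x | ρ ≤ ‖x‖ ∧ ‖x‖ ≤ 1} ⊆ U ∧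
      HarmonicOnNhd (annulusImages n ρ y) U := by
  obtain ⟨U, hU, hsub, d, hd, β, hb⟩ := exists_image_bound hρ h₁ h₂
  refine ⟨U, hsub, ?_⟩
  have hs0 : 0 < ‖y‖ := hρ.1.trans h₁
  have hρ0 := hρ.1
  have hw := summable_pow_pow hn hρ
  have hw' : Summable fun l : ℕ => (ρ ^ n) ^ (l + 1) := (summable_nat_add_iff 1).2 hw
  have hw0 : ∀ l : ℕ, 0 ≤ (ρ ^ n) ^ l := fun l => by positivity
  have hβ : ∀ x ∈ U, ‖x‖ ≤ β := fun x hx => (hb x hx).1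
  have hq0 : 0 < ρ ^ 2 := by positivity
  have hq1 : ρ ^ 2 ≤ 1 := pow_le_one₀ hρ0.le hρ.2.le
  have hql : ∀ l : ℕ, (ρ ^ 2) ^ l ≤ 1 := fun l => pow_le_one₀ hq0.le hq1
  have hyn : ∀ b : ℝ, 0 ≤ b → ‖b • y‖ = b * ‖y‖ := fun b hb => by
    rw [norm_smul, Real.norm_of_nonneg hb]
  have hss : ‖y‖⁻¹ * ‖y‖ = 1 := inv_mul_cancel₀ hs0.ne'
  unfold annulusImages
  refine HarmonicOnNhd.sub (HarmonicOnNhd.add (HarmonicOnNhd.sub ?_ ?_) ?_) ?_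
  · refine harmonicOnNhd_imageSum hE hU hw hw0 (fun l => by positivity)
      (fun l => mul_le_one₀ h₂.le (by positivity) (hql l)) (fun l => ?_) hd hβ
      fun x hx l => ((hb x hx).2 l).1
    rw [hyn _ (by positivity), hss]
  · refine harmonicOnNhd_imageSum hE hU hw' (fun l => hw0 _) (fun l => by positivity)
      (fun l => hql _) (fun l => ?_) hd hβ fun x hx l => ((hb x hx).2 l).2.1
    rw [hyn _ (by positivity), one_mul]
    exact h₂.le
  · refine harmonicOnNhd_imageSum hE hU hw' (fun l => hw0 _) (fun l => by positivity)
      (fun l => h₂.le) (fun l => ?_) hd hβ fun x hx l => ((hb x hx).2 l).2.2.1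
    rw [hyn _ (by positivity), mul_assoc, hss, mul_one]
    exact hql _
  · refine harmonicOnNhd_imageSum hE hU hw' (fun l => hw0 _) (fun l => zero_le_one)
      (fun l => le_rfl) (fun l => ?_) hd hβ fun x hx l => ((hb x hx).2 l).2.2.2
    rw [hyn _ (by positivity)]
    exact mul_le_one₀ (hql _) (norm_nonneg y) h₂.le

/-- Points inverse in a sphere have proportional distances to its points, so on each boundary sphere
the images cancel in pairs and only the original charge survives. -/
theorem annulusImages_of_mem_sphere {n : ℕ} (hn : 1 ≤ n) {ρ : ℝ} (hρ : ρ ∈ Ioo (0 : ℝ) 1)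
    {x y : E} (h₁ : ρ < ‖y‖) (h₂ : ‖y‖ < 1) (hx : ‖x‖ = ρ ∨ ‖x‖ = 1) :
    annulusImages n ρ y x = (‖x - y‖ ^ n)⁻¹ := by
  obtain ⟨U, -, hsub, d, hd, β, hb⟩ := exists_image_bound hρ h₁ h₂
  have hs0 : 0 < ‖y‖ := hρ.1.trans h₁
  have hρ0 := hρ.1
  have hw := summable_pow_pow hn hρ
  have hw' : Summable fun l : ℕ => (ρ ^ n) ^ (l + 1) := (summable_nat_add_iff 1).2 hw
  have hw0 : ∀ l : ℕ, 0 ≤ (ρ ^ n) ^ l := fun l => by positivity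
  have hbx := (hb x (hsub (by rcases hx with h | h <;> simp [h, hρ.2.le]))).2
  have S1 := summable_imageSum (n := n) hw hw0 hd fun l => (hbx l).1
  have S3 := summable_imageSum (n := n) hw' (fun l => hw0 _) hd fun l => (hbx l).2.2.1
  have norm_eq : ∀ {a b c e k : ℝ}, 0 ≤ k →
      a ^ 2 * ‖x‖ ^ 2 - 2 * (a * b) * inner ℝ x y + b ^ 2 * ‖y‖ ^ 2 =
      k ^ 2 * (c ^ 2 * ‖x‖ ^ 2 - 2 * (c * e) * inner ℝ x y + e ^ 2 * ‖y‖ ^ 2) →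
      ‖a • x - b • y‖ = k * ‖c • x - e • y‖ := by
    intro a b c e k hk h
    rw [← sq_eq_sq₀ (norm_nonneg _) (by positivity), mul_pow, norm_smul_sub_smul_sq,
      norm_smul_sub_smul_sq, h]
  have hss : ‖y‖⁻¹ * ‖y‖ = 1 := inv_mul_cancel₀ hs0.ne'
  unfold annulusImages
  rcases hx with hx | hx
  -- On `‖x‖ = ρ` the fourth series cancels the first, and the third is the second with one extra
  -- term `l = 0`, namely `‖x - y‖⁻ⁿ`.
  · have e14 : ∀ l : ℕ, (ρ ^ n) ^ (l + 1) * (‖(1 : ℝ) • x - (ρ ^ 2) ^ (l + 1) • y‖ ^ n)⁻¹ =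
        (ρ ^ n) ^ l * (‖(‖y‖ * (ρ ^ 2) ^ l) • x - ‖y‖⁻¹ • y‖ ^ n)⁻¹ := by
      intro l
      rw [norm_eq (c := ‖y‖ * (ρ ^ 2) ^ l) (e := ‖y‖⁻¹) hρ0.le, mul_pow]
      · field_simp
        ring
      · rw [hx]
        field_simp
        ring
    have e3 : ∀ l : ℕ, (ρ ^ n) ^ (l + 1) *
        (‖‖y‖ • x - ((ρ ^ 2) ^ (l + 1) * ‖y‖⁻¹) • y‖ ^ n)⁻¹ =
        (ρ ^ n) ^ l * (‖(ρ ^ 2) ^ l • x - (1 : ℝ) • y‖ ^ n)⁻¹ := by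
      intro l
      rw [norm_eq (c := (ρ ^ 2) ^ l) (e := 1) hρ0.le, mul_pow]
      · field_simp
        ring
      · rw [hx]
        field_simp
        ring
    simp_rw [e3] at S3
    simp only [imageSum, e14, e3]
    rw [S3.tsum_eq_zero_add]
    simp
  -- On `‖x‖ = 1` the second and third series cancel, and the first exceeds the fourth by the term
  -- `l = 0`.
  · have e23 : ∀ l : ℕ, (ρ ^ n) ^ (l + 1) *
        (‖‖y‖ • x - ((ρ ^ 2) ^ (l + 1) * ‖y‖⁻¹) • y‖ ^ n)⁻¹ =
        (ρ ^ n) ^ (l + 1) * (‖(ρ ^ 2) ^ (l + 1) • x - (1 : ℝ) • y‖ ^ n)⁻¹ := by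
      intro l
      rw [norm_eq (c := (ρ ^ 2) ^ (l + 1)) (e := 1) zero_le_one, one_mul]
      rw [hx]
      field_simp
      ring
    have e1 : ∀ l : ℕ, (ρ ^ n) ^ l * (‖(‖y‖ * (ρ ^ 2) ^ l) • x - ‖y‖⁻¹ • y‖ ^ n)⁻¹ =
        (ρ ^ n) ^ l * (‖(1 : ℝ) • x - (ρ ^ 2) ^ l • y‖ ^ n)⁻¹ := by
      intro l
      rw [norm_eq (c := 1) (e := (ρ ^ 2) ^ l) zero_le_one, one_mul]
      rw [hx]
      field_simp
      ring
    simp_rw [e1] at S1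
    simp only [imageSum, e23, e1]
    rw [S1.tsum_eq_zero_add]
    simp

end Images

/-! ### The regular part and Green function of the annulus. -/

section Annulus

theorem isOpen_annulus (N : ℕ) (ρ : ℝ) : IsOpen (annulus N ρ) :=
  (isOpen_lt continuous_const continuous_norm).inter (isOpen_lt continuous_norm continuous_const)

theorem isBounded_annulus (N : ℕ) (ρ : ℝ) : Bornology.IsBounded (annulus N ρ) :=
  (Metric.isBounded_closedBall (x := 0) (r := 1)).subset fun x hx => by
    simpa using hx.2.le

theorem closure_annulus_subset (N : ℕ) (ρ : ℝ) :
    closure (annulus N ρ) ⊆ {x | ρ ≤ ‖x‖ ∧ ‖x‖ ≤ 1} :=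
  closure_minimal (fun _ hx => ⟨hx.1.le, hx.2.le⟩)
    ((isClosed_le continuous_const continuous_norm).inter
      (isClosed_le continuous_norm continuous_const))

theorem isCorrector_annulusImages {n : ℕ} (hn : 1 ≤ n) {ρ : ℝ} (hρ : ρ ∈ Ioo (0 : ℝ) 1)
    {y : EuclideanSpace ℝ (Fin (n + 2))} (hy : y ∈ annulus (n + 2) ρ) :
    IsCorrector (annulus (n + 2) ρ) y (newtonConst n • annulusImages n ρ y) := by
  obtain ⟨U, hU, hh⟩ :=
    exists_harmonicOnNhd_annulusImages hn finrank_euclideanSpace_fin hρ hy.1 hy.2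
  have hcl := (closure_annulus_subset (n + 2) ρ).trans hU
  have hh' := hh.const_smul (c := newtonConst n)
  refine ⟨hh'.mono (subset_closure.trans hcl), hh'.continuousOn.mono hcl, fun x hx => ?_⟩
  have hx' : ‖x‖ = ρ ∨ ‖x‖ = 1 := by
    obtain ⟨h1, h2⟩ := closure_annulus_subset _ _ hx.1
    have h3 : x ∉ annulus (n + 2) ρ := by
      rw [← (isOpen_annulus _ _).interior_eq]
      exact hx.2
    by_contra! h
    exact h3 ⟨lt_of_le_of_ne h1 h.1.symm, lt_of_le_of_ne h2 h.2⟩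
  rw [Pi.smul_apply, annulusImages_of_mem_sphere hn hρ hy.1 hy.2 hx', fundamentalSolution_eq,
    smul_eq_mul]

theorem regularPart_annulus {n : ℕ} (hn : 1 ≤ n) {ρ : ℝ} (hρ : ρ ∈ Ioo (0 : ℝ) 1)
    {x y : EuclideanSpace ℝ (Fin (n + 2))} (hx : x ∈ annulus (n + 2) ρ)
    (hy : y ∈ annulus (n + 2) ρ) :
    regularPart (annulus (n + 2) ρ) x y = newtonConst n * annulusImages n ρ y x := by
  rw [regularPart_eq (by omega) (isOpen_annulus _ _) (isBounded_annulus _ _)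
    (isCorrector_annulusImages hn hρ hy) hx, Pi.smul_apply, smul_eq_mul]

theorem green_annulus_nonneg {n : ℕ} (hn : 1 ≤ n) {ρ : ℝ} (hρ : ρ ∈ Ioo (0 : ℝ) 1)
    {x y : EuclideanSpace ℝ (Fin (n + 2))} (hx : x ∈ annulus (n + 2) ρ)
    (hy : y ∈ annulus (n + 2) ρ) (hxy : x ≠ y) : 0 ≤ green (annulus (n + 2) ρ) x y := by
  have h := isCorrector_annulusImages hn hρ hy
  rw [green, sub_nonneg, regularPart_eq (by omega) (isOpen_annulus _ _) (isBounded_annulus _ _) h hx]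
  exact h.le_fundamentalSolution hn (isOpen_annulus _ _) (isBounded_annulus _ _) hx hxy

end Annulus

/-! ### Gegenbauer generating functions summed over the polygon. -/

section Kernel

/-- The generating function of the Gegenbauer polynomials `C_m^{n/2}(t)`. -/
noncomputable def gegenbauerKernel (n : ℕ) (t z : ℝ) : ℝ := (√(1 - 2 * z * t + z ^ 2) ^ n)⁻¹

/-- The generating function of the sums of `C_m^{n/2}` over the vertices of the `k`-gon. -/
noncomputable def polygonKernel (n k : ℕ) (z : ℝ) : ℝ :=
  ∑ j : Fin k, gegenbauerKernel n (Real.cos (2 * Real.pi * (j : ℕ) / k)) z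

/-- This coefficient is `a(a + 1)⋯(a + m - 1)/m!`. -/
theorem choose_nonneg_of_pos {a : ℝ} (ha : 0 < a) (m : ℕ) : 0 ≤ Ring.choose (a + m - 1) m := by
  have h := Ring.factorial_nsmul_multichoose_eq_ascPochhammer a m
  rw [Polynomial.ascPochhammer_smeval_eq_eval, nsmul_eq_mul] at h
  have h1 := ascPochhammer_pos m a ha
  rw [← h] at h1
  have h2 : (0 : ℝ) < m.factorial := by exact_mod_cast m.factorial_pos
  have h3 := (pos_of_mul_pos_right h1 h2.le).le
  rwa [Ring.multichoose_eq] at h3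

theorem exists_hasSum_one_sub_cpow {a : ℝ} (ha : 0 < a) :
    ∃ c : ℕ → ℝ, (∀ m, 0 ≤ c m) ∧ ∀ u : ℂ, ‖u‖ < 1 →
      HasSum (fun m => (c m : ℂ) * u ^ m) (1 / (1 - u) ^ (a : ℂ)) := by
  refine ⟨fun m => Ring.choose (a + m - 1) m, choose_nonneg_of_pos ha, fun u hu => ?_⟩
  have h := (Complex.one_div_one_sub_cpow_hasFPowerSeriesOnBall_zero (a : ℂ)).hasSum (y := u)
    (by rw [← ENNReal.ofReal_one, Metric.eball_ofReal]; simpa using hu)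
  simp only [FormalMultilinearSeries.ofScalars_apply_eq, zero_add, smul_eq_mul] at h
  have hc : ∀ m : ℕ, ((Ring.choose (a + m - 1) m : ℝ) : ℂ) = Ring.choose ((a : ℂ) + m - 1) m :=
    fun m => by
      rw [Complex.ofReal_choose]
      push_cast
      rfl
  simp_rw [hc]
  exact h

/-- The radicand is `|1 - z e^{iθ}|²`; the factorization into conjugates exposes the binomial series
with exponent `-n/2`. -/
theorem gegenbauerKernel_cos_eq {n : ℕ} {θ z : ℝ} (hz : |z| < 1) :
    gegenbauerKernel n (Real.cos θ) z =
      Complex.normSq (1 / (1 - z * Complex.exp (θ * Complex.I)) ^ (((n / 2 : ℝ)) : ℂ)) := by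
  set u : ℂ := z * Complex.exp (θ * Complex.I) with hu
  have hnu : ‖u‖ < 1 := by
    rw [hu, norm_mul, Complex.norm_exp_ofReal_mul_I, mul_one, Complex.norm_real]
    exact hz
  have hne : 1 - u ≠ 0 := by
    intro h
    rw [← sub_eq_zero.1 h] at hnu
    simp at hnu
  have hsq : 1 - 2 * z * Real.cos θ + z ^ 2 = ‖1 - u‖ ^ 2 := by
    rw [Complex.sq_norm, Complex.normSq_apply]
    have h1 : u.re = z * Real.cos θ := by simp [hu, Complex.exp_ofReal_mul_I_re]
    have h2 : u.im = z * Real.sin θ := by simp [hu, Complex.exp_ofReal_mul_I_im]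
    simp only [Complex.sub_re, Complex.sub_im, Complex.one_re, Complex.one_im, h1, h2]
    nlinarith [Real.sin_sq_add_cos_sq θ]
  rw [gegenbauerKernel, hsq, Real.sqrt_sq (norm_nonneg _), Complex.normSq_eq_norm_sq, norm_div,
    norm_one, Complex.norm_cpow_real, div_pow, one_pow, one_div, ← Real.rpow_natCast (_ ^ _) 2,
    ← Real.rpow_mul (norm_nonneg _), ← Real.rpow_natCast]
  congr 2
  push_cast
  ring

/-- The geometric sum is `k` if `ζ = 1` and `0` otherwise. -/
theorem re_sum_pow_nonneg {k : ℕ} {ζ : ℂ} (hζ : ζ ^ k = 1) :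
    0 ≤ (∑ j ∈ Finset.range k, ζ ^ j).re := by
  by_cases h : ζ = 1
  · simp [h]
  · rw [geom_sum_eq h, hζ]
    simp

theorem hasSum_mul_complex {f g : ℕ → ℂ} {a b : ℂ} (hf : HasSum f a) (hg : HasSum g b) :
    HasSum (fun p : ℕ × ℕ => f p.1 * g p.2) (a * b) := by
  have hs : Summable fun p : ℕ × ℕ => f p.1 * g p.2 :=
    summable_mul_of_summable_norm hf.summable.norm hg.summable.norm
  have := hs.hasSum
  rwa [← tsum_mul_tsum_of_summable_norm hf.summable.norm hg.summable.norm, hf.tsum_eq,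
    hg.tsum_eq] at this

theorem hasSum_gegenbauerKernel {n : ℕ} {c : ℕ → ℝ}
    (hc : ∀ u : ℂ, ‖u‖ < 1 → HasSum (fun m => (c m : ℂ) * u ^ m) (1 / (1 - u) ^ ((n / 2 : ℝ) : ℂ)))
    {z : ℝ} (hz : |z| < 1) {θ : ℝ} {v : ℂ} (hv : Complex.exp (θ * Complex.I) = v) :
    HasSum (fun p : ℕ × ℕ => (c p.1 * c p.2 * z ^ (p.1 + p.2)) *
      (v ^ p.1 * (starRingEnd ℂ) v ^ p.2).re) (gegenbauerKernel n (Real.cos θ) z) := by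
  have hnv : ‖v‖ = 1 := by rw [← hv, Complex.norm_exp_ofReal_mul_I]
  have hu : ‖(z : ℂ) * v‖ < 1 := by
    rw [norm_mul, hnv, mul_one, Complex.norm_real]
    exact hz
  obtain ⟨e, he⟩ : ∃ e : ℂ, e = 1 / (1 - z * v) ^ ((n / 2 : ℝ) : ℂ) := ⟨_, rfl⟩
  have h1 : HasSum (fun m => (c m : ℂ) * (z * v) ^ m) e := he ▸ hc _ hu
  have h2 : HasSum (fun m => (starRingEnd ℂ) ((c m : ℂ) * (z * v) ^ m)) ((starRingEnd ℂ) e) :=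
    Complex.hasSum_conj'.2 h1
  have h3 := hasSum_mul_complex h1 h2
  have h5 : ∀ p : ℕ × ℕ, (c p.1 : ℂ) * (z * v) ^ p.1 *
      (starRingEnd ℂ) ((c p.2 : ℂ) * (z * v) ^ p.2) =
      ((c p.1 * c p.2 * z ^ (p.1 + p.2) : ℝ) : ℂ) * (v ^ p.1 * (starRingEnd ℂ) v ^ p.2) := by
    intro p
    simp only [map_mul, map_pow, Complex.conj_ofReal]
    push_cast
    ring
  rw [Complex.mul_conj] at h3
  have h4 := Complex.hasSum_re h3
  simp only [h5, Complex.re_ofReal_mul, Complex.ofReal_re] at h4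
  rw [gegenbauerKernel_cos_eq hz, hv, ← he]
  exact h4

/-- `polygonKernel` is absolutely monotone on `[0, 1)`. -/
theorem exists_hasSum_polygonKernel {n k : ℕ} (hn : 1 ≤ n) (hk : 1 ≤ k) :
    ∃ C : ℕ × ℕ → ℝ, (∀ p, 0 ≤ C p) ∧ ∀ z ∈ Ico (0 : ℝ) 1,
      HasSum (fun p => C p * z ^ (p.1 + p.2)) (polygonKernel n k z) := by
  have hn' : (0 : ℝ) < n / 2 := by
    have : (0 : ℝ) < n := by exact_mod_cast hn
    positivity
  obtain ⟨c, hc0, hc⟩ := exists_hasSum_one_sub_cpow hn'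
  have hk' : (k : ℂ) ≠ 0 := by exact_mod_cast (by omega : k ≠ 0)
  obtain ⟨ω, hω⟩ : ∃ ω : ℂ, ω = Complex.exp (2 * Real.pi * Complex.I / k) := ⟨_, rfl⟩
  have hωk : ω ^ k = 1 := by
    rw [hω, ← Complex.exp_nat_mul, mul_div_cancel₀ _ hk', Complex.exp_two_pi_mul_I]
  have hζk : ∀ p : ℕ × ℕ, (ω ^ p.1 * (starRingEnd ℂ) ω ^ p.2) ^ k = 1 := fun p => by
    rw [mul_pow, ← pow_mul, ← pow_mul, mul_comm p.1, mul_comm p.2, pow_mul, pow_mul, ← map_pow,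
      hωk]
    simp
  -- The phase of the term `(p.1, p.2)` at vertex `j` is the `j`-th power of a `k`-th root of unity,
  -- so summing over `j` leaves a nonnegative coefficient.
  refine ⟨fun p => c p.1 * c p.2 *
    (∑ j ∈ Finset.range k, (ω ^ p.1 * (starRingEnd ℂ) ω ^ p.2) ^ j).re,
    fun p => mul_nonneg (mul_nonneg (hc0 _) (hc0 _)) (re_sum_pow_nonneg (hζk p)), fun z hz => ?_⟩
  have hz' : |z| < 1 := by rw [abs_of_nonneg hz.1]; exact hz.2
  have hexp : ∀ j : ℕ,
      Complex.exp (((2 * Real.pi * j / k : ℝ) : ℂ) * Complex.I) = ω ^ j := fun j => by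
    rw [hω, ← Complex.exp_nat_mul]
    congr 1
    push_cast
    ring
  have hsum := hasSum_sum (s := Finset.range k) fun j _ => hasSum_gegenbauerKernel hc hz' (hexp j)
  rw [polygonKernel,
    Fin.sum_univ_eq_sum_range (fun j => gegenbauerKernel n (Real.cos (2 * Real.pi * j / k)) z)]
  convert hsum using 2 with p
  rw [← Finset.mul_sum, ← Complex.re_sum, mul_right_comm]
  congr 2
  refine Finset.sum_congr rfl fun j _ => ?_
  rw [map_pow, mul_pow, ← pow_mul, ← pow_mul, ← pow_mul, ← pow_mul, mul_comm j, mul_comm j]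

theorem gegenbauerKernel_radicand_pos {t z : ℝ} (ht : |t| ≤ 1) (hz : |z| < 1) :
    0 < 1 - 2 * z * t + z ^ 2 := by
  have h1 : z * t ≤ |z| := by
    refine (le_abs_self _).trans ?_
    rw [abs_mul]
    exact mul_le_of_le_one_right (abs_nonneg z) ht
  nlinarith [sq_abs z]

theorem differentiableAt_gegenbauerKernel {n : ℕ} {t z : ℝ} (ht : |t| ≤ 1) (hz : |z| < 1) :
    DifferentiableAt ℝ (gegenbauerKernel n t) z := by
  have h := gegenbauerKernel_radicand_pos ht hz
  unfold gegenbauerKernel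
  have h2 : DifferentiableAt ℝ (fun z => √(1 - 2 * z * t + z ^ 2)) z :=
    DifferentiableAt.sqrt (by fun_prop) h.ne'
  exact (h2.pow n).inv (pow_pos (Real.sqrt_pos.2 h) n).ne'

theorem gegenbauerKernel_nonneg (n : ℕ) (t z : ℝ) : 0 ≤ gegenbauerKernel n t z := by
  unfold gegenbauerKernel
  positivity

theorem differentiableAt_polygonKernel {n k : ℕ} {z : ℝ} (hz : |z| < 1) :
    DifferentiableAt ℝ (polygonKernel n k) z := by
  unfold polygonKernel
  exact DifferentiableAt.fun_sum fun j _ =>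
    differentiableAt_gegenbauerKernel (Real.abs_cos_le_one _) hz

theorem monotoneOn_polygonKernel {n k : ℕ} (hn : 1 ≤ n) (hk : 1 ≤ k) :
    MonotoneOn (polygonKernel n k) (Ico 0 1) := by
  obtain ⟨C, hC0, hC⟩ := exists_hasSum_polygonKernel hn hk
  intro x hx y hy hxy
  exact hasSum_le (fun p => mul_le_mul_of_nonneg_left (pow_le_pow_left₀ hx.1 hxy _) (hC0 p))
    (hC x hx) (hC y hy)

theorem convexOn_polygonKernel {n k : ℕ} (hn : 1 ≤ n) (hk : 1 ≤ k) :
    ConvexOn ℝ (Ico 0 1) (polygonKernel n k) := by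
  obtain ⟨C, hC0, hC⟩ := exists_hasSum_polygonKernel hn hk
  refine ⟨convex_Ico 0 1, fun x hx y hy a b ha hb hab => ?_⟩
  refine hasSum_le (fun p => ?_) (hC _ (convex_Ico 0 1 hx hy ha hb hab))
    (((hC x hx).mul_left a).add ((hC y hy).mul_left b))
  have := (convexOn_pow (p.1 + p.2)).2 (mem_Ici.2 hx.1) (mem_Ici.2 hy.1) ha hb hab
  have := mul_le_mul_of_nonneg_left this (hC0 p)
  simp only [smul_eq_mul] at this ⊢
  linarith

/-- The vertex `j = 0` alone contributes `(1 - z)⁻ⁿ`. This forces the blow-up at both ends of `(ρ,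
1)`. -/
theorem inv_one_sub_le_polygonKernel {n k : ℕ} (hn : 1 ≤ n) (hk : 1 ≤ k) {z : ℝ}
    (hz : z ∈ Ico (0 : ℝ) 1) : (1 - z)⁻¹ ≤ polygonKernel n k z := by
  have h0 : 0 < 1 - z := by linarith [hz.2]
  have h1 : gegenbauerKernel n 1 z = ((1 - z) ^ n)⁻¹ := by
    rw [gegenbauerKernel, show 1 - 2 * z * 1 + z ^ 2 = (1 - z) ^ 2 by ring, Real.sqrt_sq h0.le]
  have h2 : gegenbauerKernel n 1 z ≤ polygonKernel n k z := by
    have := Finset.single_le_sum (f := fun j : Fin k =>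
      gegenbauerKernel n (Real.cos (2 * Real.pi * (j : ℕ) / k)) z)
      (fun j _ => gegenbauerKernel_nonneg n _ z) (Finset.mem_univ (⟨0, hk⟩ : Fin k))
    simp only [Nat.cast_zero, mul_zero, zero_div, Real.cos_zero] at this
    exact this
  refine le_trans ?_ h2
  rw [h1]
  exact inv_anti₀ (by positivity) (pow_le_of_le_one h0.le (by linarith [hz.1]) (by omega))

end Kernel

/-! ### Dilation series and the one-variable critical point argument. -/

section Calculus

theorem deriv_nonneg_of_monotoneOn_Ico {A : ℝ → ℝ} (hm : MonotoneOn A (Ico 0 1)) {z : ℝ}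
    (hz : z ∈ Ioo (0 : ℝ) 1) : 0 ≤ deriv A z := by
  rw [← derivWithin_of_isOpen isOpen_Ioo hz]
  exact (hm.mono Ioo_subset_Ico_self).derivWithin_nonneg

theorem monotoneOn_deriv_of_convexOn_Ico {A : ℝ → ℝ} (hc : ConvexOn ℝ (Ico 0 1) A)
    (hd : ∀ z ∈ Ioo (0 : ℝ) 1, DifferentiableAt ℝ A z) : MonotoneOn (deriv A) (Ioo 0 1) :=
  (hc.subset Ioo_subset_Ico_self (convex_Ioo 0 1)).monotoneOn_deriv hd

/-- Geometric superposition of the dilations of a function. -/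
noncomputable def dilationSeries (w q : ℝ) (K : ℝ → ℝ) (z : ℝ) : ℝ := ∑' l : ℕ, w ^ l * K (q ^ l * z)

variable {w q : ℝ} {K : ℝ → ℝ}

theorem pow_mul_mem_Ico (hq : q ∈ Ioo (0 : ℝ) 1) {z : ℝ} (hz : z ∈ Ico (0 : ℝ) 1) (l : ℕ) :
    q ^ l * z ∈ Ico (0 : ℝ) 1 ∧ q ^ l * z ≤ z := by
  have h1 : q ^ l * z ≤ z := mul_le_of_le_one_left hz.1 (pow_le_one₀ hq.1.le hq.2.le)
  exact ⟨⟨mul_nonneg (pow_nonneg hq.1.le l) hz.1, h1.trans_lt hz.2⟩, h1⟩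

theorem summable_dilationSeries (hw : w ∈ Ioo (0 : ℝ) 1) (hq : q ∈ Ioo (0 : ℝ) 1)
    (hm : MonotoneOn K (Ico 0 1)) (h0 : 0 ≤ K 0) {z : ℝ} (hz : z ∈ Ico (0 : ℝ) 1) :
    Summable fun l : ℕ => w ^ l * K (q ^ l * z) := by
  refine Summable.of_nonneg_of_le (fun l => mul_nonneg (pow_nonneg hw.1.le l) ?_)
    (fun l => mul_le_mul_of_nonneg_left (hm (pow_mul_mem_Ico hq hz l).1 hz
      (pow_mul_mem_Ico hq hz l).2) (pow_nonneg hw.1.le l))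
    ((summable_geometric_of_lt_one hw.1.le hw.2).mul_right (K z))
  exact h0.trans (hm ⟨le_rfl, one_pos⟩ (pow_mul_mem_Ico hq hz l).1 (pow_mul_mem_Ico hq hz l).1.1)

theorem monotoneOn_dilationSeries (hw : w ∈ Ioo (0 : ℝ) 1) (hq : q ∈ Ioo (0 : ℝ) 1)
    (hm : MonotoneOn K (Ico 0 1)) (h0 : 0 ≤ K 0) : MonotoneOn (dilationSeries w q K) (Ico 0 1) := by
  intro x hx y hy hxy
  refine (summable_dilationSeries hw hq hm h0 hx).tsum_le_tsum (fun l => ?_)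
    (summable_dilationSeries hw hq hm h0 hy)
  refine mul_le_mul_of_nonneg_left (hm (pow_mul_mem_Ico hq hx l).1 (pow_mul_mem_Ico hq hy l).1 ?_)
    (pow_nonneg hw.1.le l)
  exact mul_le_mul_of_nonneg_left hxy (pow_nonneg hq.1.le l)

theorem convexOn_dilationSeries (hw : w ∈ Ioo (0 : ℝ) 1) (hq : q ∈ Ioo (0 : ℝ) 1)
    (hm : MonotoneOn K (Ico 0 1)) (hc : ConvexOn ℝ (Ico 0 1) K) (h0 : 0 ≤ K 0) :
    ConvexOn ℝ (Ico 0 1) (dilationSeries w q K) := by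
  refine ⟨convex_Ico 0 1, fun x hx y hy a b ha hb hab => ?_⟩
  have hs := fun {z : ℝ} (hz : z ∈ Ico (0 : ℝ) 1) => (summable_dilationSeries hw hq hm h0 hz).hasSum
  refine hasSum_le (fun l => ?_) (hs (convex_Ico 0 1 hx hy ha hb hab))
    (((hs hx).mul_left a).add ((hs hy).mul_left b))
  have h1 := hc.2 (pow_mul_mem_Ico hq hx l).1 (pow_mul_mem_Ico hq hy l).1 ha hb hab
  have h2 := mul_le_mul_of_nonneg_left h1 (pow_nonneg hw.1.le l)
  simp only [smul_eq_mul] at h2 ⊢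
  rw [show q ^ l * (a * x + b * y) = a * (q ^ l * x) + b * (q ^ l * y) by ring]
  linarith

/-- Convexity makes `K'` monotone, so on `(0, z₁)` the termwise derivatives are dominated by `wˡ
K'(z₁)`. -/
theorem differentiableAt_dilationSeries (hw : w ∈ Ioo (0 : ℝ) 1) (hq : q ∈ Ioo (0 : ℝ) 1)
    (hm : MonotoneOn K (Ico 0 1)) (hc : ConvexOn ℝ (Ico 0 1) K) (h0 : 0 ≤ K 0)
    (hd : ∀ z ∈ Ioo (0 : ℝ) 1, DifferentiableAt ℝ K z) {z : ℝ} (hz : z ∈ Ioo (0 : ℝ) 1) :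
    DifferentiableAt ℝ (dilationSeries w q K) z := by
  obtain ⟨z₁, hz₁, hz₁'⟩ := exists_between hz.2
  have hz₁I : z₁ ∈ Ioo (0 : ℝ) 1 := ⟨hz.1.trans hz₁, hz₁'⟩
  have hmem : ∀ l : ℕ, ∀ y ∈ Ioo 0 z₁, q ^ l * y ∈ Ioo (0 : ℝ) 1 ∧ q ^ l * y ≤ z₁ := fun l y hy => by
    have h1 := pow_mul_mem_Ico hq (z := y) ⟨hy.1.le, hy.2.trans hz₁'⟩ l
    exact ⟨⟨mul_pos (pow_pos hq.1 l) hy.1, h1.1.2⟩, h1.2.trans hy.2.le⟩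
  refine (hasDerivAt_tsum_of_isPreconnected
    (u := fun l : ℕ => w ^ l * deriv K z₁) (t := Ioo 0 z₁)
    (g' := fun l y => w ^ l * (deriv K (q ^ l * y) * q ^ l))
    ((summable_geometric_of_lt_one hw.1.le hw.2).mul_right _) isOpen_Ioo isPreconnected_Ioo
    (fun l y hy => ?_) (fun l y hy => ?_) (y₀ := z) ⟨hz.1, hz₁⟩
    (summable_dilationSeries hw hq hm h0 (Ioo_subset_Ico_self hz)) ⟨hz.1, hz₁⟩).differentiableAt
  · have h1 : HasDerivAt (fun y => q ^ l * y) (q ^ l) y := by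
      simpa using (hasDerivAt_id y).const_mul (q ^ l)
    exact ((hd _ (hmem l y hy).1).hasDerivAt.comp y h1).const_mul (w ^ l)
  · have h1 := deriv_nonneg_of_monotoneOn_Ico hm (hmem l y hy).1
    have h2 := monotoneOn_deriv_of_convexOn_Ico hc hd (hmem l y hy).1 hz₁I (hmem l y hy).2
    have hw0 := pow_nonneg hw.1.le l
    have hq0 := pow_nonneg hq.1.le l
    rw [Real.norm_of_nonneg (by positivity)]
    exact mul_le_mul_of_nonneg_left
      ((mul_le_of_le_one_right h1 (pow_le_one₀ hq.1.le hq.2.le)).trans h2) hw0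

theorem le_dilationSeries (hw : w ∈ Ioo (0 : ℝ) 1) (hq : q ∈ Ioo (0 : ℝ) 1)
    (hm : MonotoneOn K (Ico 0 1)) (h0 : 0 ≤ K 0) {z : ℝ} (hz : z ∈ Ico (0 : ℝ) 1) :
    K z ≤ dilationSeries w q K z := by
  have h := (summable_dilationSeries hw hq hm h0 hz).le_tsum 0 fun l _ =>
    mul_nonneg (pow_nonneg hw.1.le l) (h0.trans (hm ⟨le_rfl, one_pos⟩
      (pow_mul_mem_Ico hq hz l).1 (pow_mul_mem_Ico hq hz l).1.1))
  simp only [pow_zero, one_mul] at h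
  exact h

variable {A : ℝ → ℝ}

theorem tendsto_inv_one_sub : Tendsto (fun z : ℝ => (1 - z)⁻¹) (𝓝[<] 1) atTop := by
  refine tendsto_inv_nhdsGT_zero.comp (tendsto_nhdsWithin_iff.2 ⟨?_, ?_⟩)
  · have : Continuous fun z : ℝ => 1 - z := by fun_prop
    simpa using (this.tendsto 1).mono_left nhdsWithin_le_nhds
  · filter_upwards [self_mem_nhdsWithin] with z hz
    exact sub_pos.2 (mem_Iio.1 hz)

theorem eventually_mem_Ioo_left {a : ℝ} (ha : a < 1) : ∀ᶠ z in 𝓝[<] (1 : ℝ), z ∈ Ioo a 1 :=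
  Ioo_mem_nhdsLT ha

theorem tendsto_atTop_of_inv_one_sub_le (hA : ∀ z ∈ Ico (0 : ℝ) 1, (1 - z)⁻¹ ≤ A z) :
    Tendsto A (𝓝[<] 1) atTop := by
  refine tendsto_atTop_mono' _ ?_ tendsto_inv_one_sub
  filter_upwards [eventually_mem_Ioo_left one_pos] with z hz using hA z (Ioo_subset_Ico_self hz)

theorem tendsto_deriv_atTop (hm : MonotoneOn A (Ico 0 1)) (hc : ConvexOn ℝ (Ico 0 1) A)
    (hd : ∀ z ∈ Ioo (0 : ℝ) 1, DifferentiableAt ℝ A z)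
    (hA : ∀ z ∈ Ico (0 : ℝ) 1, (1 - z)⁻¹ ≤ A z) : Tendsto (deriv A) (𝓝[<] 1) atTop := by
  refine tendsto_atTop_mono' _ ?_
    (tendsto_atTop_add_const_right _ (-A (1 / 2)) (tendsto_atTop_of_inv_one_sub_le hA))
  filter_upwards [eventually_mem_Ioo_left (by norm_num : (1 / 2 : ℝ) < 1)] with z hz
  have hz0 : z ∈ Ioo (0 : ℝ) 1 := ⟨by linarith [hz.1], hz.2⟩
  -- By convexity the slope over `[1/2, z]` is at most `A'(z)`, so `A(z) - A(1/2) ≤ A'(z)`.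
  obtain ⟨x, hx, hx'⟩ := exists_deriv_eq_slope A hz.1
    (fun y hy => (hd y ⟨by linarith [hy.1], hy.2.trans_lt hz.2⟩).continuousAt.continuousWithinAt)
    (fun y hy => (hd y ⟨by linarith [hy.1], hy.2.trans hz.2⟩).differentiableWithinAt)
  have hx0 : x ∈ Ioo (0 : ℝ) 1 := ⟨by linarith [hx.1], hx.2.trans hz.2⟩
  have h1 := monotoneOn_deriv_of_convexOn_Ico hc hd hx0 hz0 hx.2.le
  have h2 := deriv_nonneg_of_monotoneOn_Ico hm hz0
  rw [hx', div_le_iff₀ (by linarith [hz.1])] at h1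
  nlinarith [hz.2]

/-- Multiplying `L'` by `r^(n+1)/c` turns the `D` term into the constant `n D`, so neither its sign
nor its size matters. What remains is `P + n D - Q`, with `P` nondecreasing and `Q` strictly
decreasing. -/
theorem unique_critical_point {n : ℕ} (hn : 1 ≤ n) {ρ c D : ℝ} (hρ : ρ ∈ Ioo (0 : ℝ) 1) (hc0 : 0 < c)
    (hm : MonotoneOn A (Ico 0 1)) (hc : ConvexOn ℝ (Ico 0 1) A)
    (hd : ∀ z ∈ Ioo (0 : ℝ) 1, DifferentiableAt ℝ A z)
    (hA : ∀ z ∈ Ico (0 : ℝ) 1, (1 - z)⁻¹ ≤ A z) {L : ℝ → ℝ}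
    (hL : ∀ r ∈ Ioo ρ 1,
      L r = c * (A (r ^ 2) - D * (r ^ n)⁻¹ + ρ ^ n * ((r ^ n)⁻¹ ^ 2 * A (ρ ^ 2 / r ^ 2)))) :
    DifferentiableOn ℝ L (Ioo ρ 1) ∧
      ∃ r₀ ∈ Ioo ρ 1, (∀ r ∈ Ioo ρ 1, deriv L r = 0 ↔ r = r₀) ∧ IsMinOn L (Ioo ρ 1) r₀ := by
  obtain ⟨hρ0, hρ1⟩ := hρ
  have hnR : (1 : ℝ) ≤ n := by exact_mod_cast hn
  have hApos : ∀ z ∈ Ioo (0 : ℝ) 1, 0 < A z := fun z hz =>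
    (inv_pos.2 (by linarith [hz.2])).trans_le (hA z (Ioo_subset_Ico_self hz))
  have hd0 : ∀ z ∈ Ioo (0 : ℝ) 1, 0 ≤ deriv A z := fun z hz => deriv_nonneg_of_monotoneOn_Ico hm hz
  have hdm := monotoneOn_deriv_of_convexOn_Ico hc hd
  have hmem₁ : ∀ r ∈ Ioo ρ 1, r ^ 2 ∈ Ioo (0 : ℝ) 1 := fun r hr => by
    have : 0 < r := hρ0.trans hr.1
    exact ⟨by positivity, pow_lt_one₀ this.le hr.2 two_ne_zero⟩
  have hmem₂ : ∀ r ∈ Ioo ρ 1, ρ ^ 2 / r ^ 2 ∈ Ioo (0 : ℝ) 1 := fun r hr => by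
    have : 0 < r := hρ0.trans hr.1
    refine ⟨by positivity, ?_⟩
    rw [div_lt_one (by positivity)]
    exact pow_lt_pow_left₀ hr.1 hρ0.le two_ne_zero
  set P : ℝ → ℝ := fun r => 2 * r ^ (n + 2) * deriv A (r ^ 2) with hP
  set Q : ℝ → ℝ := fun r => 2 * ρ ^ n * (r ^ n)⁻¹ *
    (n * A (ρ ^ 2 / r ^ 2) + ρ ^ 2 / r ^ 2 * deriv A (ρ ^ 2 / r ^ 2)) with hQ
  have hPm : MonotoneOn P (Ioo ρ 1) := by
    intro r hr s hs hrs
    have hr0 : 0 < r := hρ0.trans hr.1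
    have hs0 : 0 < s := hρ0.trans hs.1
    have h1 := hdm (hmem₁ r hr) (hmem₁ s hs) (by gcongr)
    have h2 := hd0 _ (hmem₁ r hr)
    simp only [hP]
    gcongr
  have hQm : StrictAntiOn Q (Ioo ρ 1) := by
    intro r hr s hs hrs
    have hr0 : 0 < r := hρ0.trans hr.1
    have hle : ρ ^ 2 / s ^ 2 ≤ ρ ^ 2 / r ^ 2 := by gcongr
    have h1 := hdm (hmem₂ s hs) (hmem₂ r hr) hle
    have h2 := hd0 _ (hmem₂ s hs)
    have h3 := hm (Ioo_subset_Ico_self (hmem₂ s hs)) (Ioo_subset_Ico_self (hmem₂ r hr)) hle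
    have h4 := hApos _ (hmem₂ r hr)
    have h5 := hApos _ (hmem₂ s hs)
    have h6 := (hmem₂ s hs).1
    have h7 : (s ^ n)⁻¹ < (r ^ n)⁻¹ :=
      inv_strictAnti₀ (by positivity) (pow_lt_pow_left₀ hrs hr0.le (by omega))
    simp only [hQ]
    have h8 : (n * A (ρ ^ 2 / s ^ 2) + ρ ^ 2 / s ^ 2 * deriv A (ρ ^ 2 / s ^ 2)) ≤
        (n * A (ρ ^ 2 / r ^ 2) + ρ ^ 2 / r ^ 2 * deriv A (ρ ^ 2 / r ^ 2)) := by gcongr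
    have h9 : 0 < n * A (ρ ^ 2 / s ^ 2) + ρ ^ 2 / s ^ 2 * deriv A (ρ ^ 2 / s ^ 2) := by positivity
    have hs0 : 0 < s := hr0.trans hrs
    exact mul_lt_mul (by gcongr) h8 h9 (by positivity)
  set g : ℝ → ℝ := fun r => P r + n * D - Q r with hg
  have hgm : StrictMonoOn g (Ioo ρ 1) := fun r hr s hs hrs => by
    have h1 := hPm hr hs hrs.le
    have h2 := hQm hr hs hrs
    simp only [hg]
    linarith
  have hderiv : ∀ r ∈ Ioo ρ 1, HasDerivAt L (c * ((r ^ (n + 1))⁻¹ * g r)) r := by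
    intro r hr
    have hr0 : 0 < r := hρ0.trans hr.1
    have e1 : HasDerivAt (fun r : ℝ => A (r ^ 2)) (deriv A (r ^ 2) * (2 * r)) r := by
      have h : HasDerivAt (fun r : ℝ => r ^ 2) (2 * r) r := by simpa using hasDerivAt_pow 2 r
      exact HasDerivAt.comp (h := fun r : ℝ => r ^ 2) r (hd _ (hmem₁ r hr)).hasDerivAt h
    have e2 : HasDerivAt (fun r : ℝ => (r ^ n)⁻¹) (-(n * r ^ (n - 1)) / (r ^ n) ^ 2) r :=
      (hasDerivAt_pow n r).inv (by positivity)
    have e3 : HasDerivAt (fun r : ℝ => ρ ^ 2 / r ^ 2) (-(2 * ρ ^ 2) / r ^ 3) r := by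
      have := (hasDerivAt_const r (ρ ^ 2)).div (hasDerivAt_pow 2 r) (by positivity)
      refine this.congr_deriv ?_
      field_simp
      ring
    have e4 : HasDerivAt (fun r : ℝ => A (ρ ^ 2 / r ^ 2))
        (deriv A (ρ ^ 2 / r ^ 2) * (-(2 * ρ ^ 2) / r ^ 3)) r :=
      (hd _ (hmem₂ r hr)).hasDerivAt.comp r e3
    have e5 := ((e1.sub (e2.const_mul D)).add
      (((e2.pow 2).mul e4).const_mul (ρ ^ n))).const_mul c
    have e6 : L =ᶠ[𝓝 r] fun r => c * (A (r ^ 2) - D * (r ^ n)⁻¹ +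
        ρ ^ n * ((r ^ n)⁻¹ ^ 2 * A (ρ ^ 2 / r ^ 2))) := by
      filter_upwards [isOpen_Ioo.mem_nhds hr] with s hs using hL s hs
    refine HasDerivAt.congr_of_eventuallyEq ?_ e6
    refine e5.congr_deriv ?_
    obtain ⟨m, rfl⟩ : ∃ m, n = m + 1 := ⟨n - 1, by omega⟩
    simp only [hg, hP, hQ, Nat.add_sub_cancel, Pi.pow_apply, show 2 - 1 = 1 from rfl, pow_one]
    field_simp
    ring
  have hlim : Tendsto (fun r : ℝ => r ^ 2) (𝓝[<] 1) (𝓝[<] 1) := by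
    refine tendsto_nhdsWithin_iff.2 ⟨?_, ?_⟩
    · have : Continuous fun z : ℝ => z ^ 2 := by fun_prop
      simpa using (this.tendsto 1).mono_left nhdsWithin_le_nhds
    · filter_upwards [eventually_mem_Ioo_left hρ1] with r hr using (hmem₁ r hr).2
  have hlim' : Tendsto (fun r : ℝ => ρ ^ 2 / r ^ 2) (𝓝[>] ρ) (𝓝[<] 1) := by
    refine tendsto_nhdsWithin_iff.2 ⟨?_, ?_⟩
    · have : ContinuousAt (fun z : ℝ => ρ ^ 2 / z ^ 2) ρ :=
        continuousAt_const.div (by fun_prop) (by positivity)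
      have h := this.tendsto.mono_left (nhdsWithin_le_nhds (s := Ioi ρ))
      rwa [div_self (by positivity)] at h
    · filter_upwards [Ioo_mem_nhdsGT hρ1] with r hr using (hmem₂ r hr).2
  obtain ⟨r', hr'⟩ : (Ioo ρ 1).Nonempty := nonempty_Ioo.2 hρ1
  have hr'0 : 0 < r' := hρ0.trans hr'.1
  -- Near `1`, `A'(r²)` drives `P` above `Q r' - n D`, while `Q r < Q r'`.
  obtain ⟨rp, hrp, hgp⟩ : ∃ r ∈ Ioo ρ 1, 0 < g r := by
    have h := ((tendsto_deriv_atTop hm hc hd hA).comp hlim).eventually_gt_atTop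
      ((Q r' - n * D) / (2 * r' ^ (n + 2)))
    obtain ⟨r, h1, h2⟩ := (h.and (eventually_mem_Ioo_left hr'.2)).exists
    have hr : r ∈ Ioo ρ 1 := ⟨hr'.1.trans h2.1, h2.2⟩
    refine ⟨r, hr, ?_⟩
    have h3 := hQm hr' hr h2.1
    simp only [Function.comp_apply] at h1
    rw [div_lt_iff₀ (by positivity)] at h1
    have h4 : deriv A (r ^ 2) * (2 * r' ^ (n + 2)) ≤ P r := by
      have := hd0 _ (hmem₁ r hr)
      have h5 : r' ^ (n + 2) ≤ r ^ (n + 2) := pow_le_pow_left₀ hr'0.le h2.1.le _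
      simp only [hP]
      nlinarith
    simp only [hg]
    linarith
  -- Near `ρ`, `A(ρ²/r²)` drives `Q` above `P r' + n D`, while `P r ≤ P r'`.
  obtain ⟨rn, hrn, hgn⟩ : ∃ r ∈ Ioo ρ 1, g r < 0 := by
    have h := ((tendsto_atTop_of_inv_one_sub_le hA).comp hlim').eventually_gt_atTop
      ((P r' + n * D) / (2 * ρ ^ n))
    obtain ⟨r, h1, h2⟩ := (h.and (Ioo_mem_nhdsGT hr'.1)).exists
    have hr : r ∈ Ioo ρ 1 := ⟨h2.1, h2.2.trans hr'.2⟩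
    have hr0 : 0 < r := hρ0.trans hr.1
    refine ⟨r, hr, ?_⟩
    have h3 := hPm hr hr' h2.2.le
    simp only [Function.comp_apply] at h1
    rw [div_lt_iff₀ (by positivity)] at h1
    have h4 : A (ρ ^ 2 / r ^ 2) * (2 * ρ ^ n) ≤ Q r := by
      have h5 := hd0 _ (hmem₂ r hr)
      have h6 := (hmem₂ r hr).1
      have h7 := hApos _ (hmem₂ r hr)
      have h8 : 1 ≤ (r ^ n)⁻¹ := (one_le_inv₀ (by positivity)).2 (pow_le_one₀ hr0.le hr.2.le)
      simp only [hQ]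
      calc A (ρ ^ 2 / r ^ 2) * (2 * ρ ^ n)
          = 2 * ρ ^ n * 1 * (1 * A (ρ ^ 2 / r ^ 2) + 0) := by ring
        _ ≤ _ := by gcongr; positivity
    simp only [hg]
    linarith
  have hsign : ∀ r ∈ Ioo ρ 1, 0 < c * (r ^ (n + 1))⁻¹ := fun r hr => by
    have : 0 < r := hρ0.trans hr.1
    positivity
  have hdL : ∀ r ∈ Ioo ρ 1, deriv L r = c * (r ^ (n + 1))⁻¹ * g r := fun r hr => by
    rw [(hderiv r hr).deriv, mul_assoc]
  have hdiff : ∀ r ∈ Ioo ρ 1, DifferentiableAt ℝ L r := fun r hr => (hderiv r hr).differentiableAt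
  -- Darboux's theorem gives the zero without continuity of `A'`.
  obtain ⟨r₀, hr₀, hz⟩ : (0 : ℝ) ∈ deriv L '' Ioo ρ 1 := by
    refine (ordConnected_Ioo.image_deriv hdiff).out (mem_image_of_mem _ hrn)
      (mem_image_of_mem _ hrp) ⟨?_, ?_⟩
    · rw [hdL _ hrn]
      exact (mul_neg_of_pos_of_neg (hsign _ hrn) hgn).le
    · rw [hdL _ hrp]
      exact (mul_pos (hsign _ hrp) hgp).le
  have hg0 : g r₀ = 0 := by
    rw [hdL _ hr₀] at hz
    exact (mul_eq_zero.1 hz).resolve_left (hsign _ hr₀).ne'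
  refine ⟨fun r hr => (hdiff r hr).differentiableWithinAt, r₀, hr₀, fun r hr => ⟨fun h => ?_, ?_⟩, ?_⟩
  · rw [hdL _ hr] at h
    exact hgm.injOn hr hr₀ (((mul_eq_zero.1 h).resolve_left (hsign _ hr).ne').trans hg0.symm)
  · rintro rfl
    exact hz
  · intro r hr
    rcases le_total r r₀ with h | h
    · have hsub : Ioc ρ r₀ ⊆ Ioo ρ 1 := fun s hs => ⟨hs.1, hs.2.trans_lt hr₀.2⟩
      refine antitoneOn_of_deriv_nonpos (convex_Ioc ρ r₀)
        (fun s hs => (hdiff s (hsub hs)).continuousAt.continuousWithinAt)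
        (fun s hs => (hdiff s (hsub (interior_subset hs))).differentiableWithinAt)
        (fun s hs => ?_) ⟨hr.1, h⟩ ⟨hr₀.1, le_rfl⟩ h
      have hs' := interior_subset hs
      rw [hdL _ (hsub hs')]
      exact mul_nonpos_of_nonneg_of_nonpos (hsign _ (hsub hs')).le
        (hg0 ▸ hgm.monotoneOn (hsub hs') hr₀ hs'.2)
    · have hsub : Ico r₀ 1 ⊆ Ioo ρ 1 := fun s hs => ⟨hr₀.1.trans_le hs.1, hs.2⟩
      refine monotoneOn_of_deriv_nonneg (convex_Ico r₀ 1)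
        (fun s hs => (hdiff s (hsub hs)).continuousAt.continuousWithinAt)
        (fun s hs => (hdiff s (hsub (interior_subset hs))).differentiableWithinAt)
        (fun s hs => ?_) ⟨le_rfl, hr₀.2⟩ ⟨h, hr.2⟩ h
      have hs' := interior_subset hs
      rw [hdL _ (hsub hs')]
      exact mul_nonneg (hsign _ (hsub hs')).le (hg0 ▸ hgm.monotoneOn hr₀ (hsub hs') hs'.1)

end Calculus

/-! ### The least eigenvalue as a row sum. -/

section Eigenvalue

/-- The least eigenvalue of a matrix with nonpositive off-diagonal entries and constant row
sums. -/
theorem firstEigenvalue_eq_of_sum_eq {k : ℕ} (hk : 1 ≤ k) {M : Matrix (Fin k) (Fin k) ℝ} {σ : ℝ}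
    (hM : ∀ i j, i ≠ j → M i j ≤ 0) (hσ : ∀ i, ∑ j, M i j = σ) : firstEigenvalue M = σ := by
  have : Nonempty (Fin k) := ⟨⟨0, hk⟩⟩
  refine IsLeast.csInf_eq ⟨?_, ?_⟩
  · refine Module.End.hasEigenvalue_of_hasEigenvector (x := fun _ => (1 : ℝ))
      (Module.End.hasEigenvector_iff.2 ⟨Module.End.mem_eigenspace_iff.2 ?_, ?_⟩)
    · ext i
      simp [Matrix.mulVec, dotProduct, hσ]
    · intro h
      have := congrFun h ⟨0, hk⟩
      simp at this
  · intro μ hμ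
    obtain ⟨v, hv⟩ := hμ.exists_hasEigenvector
    have hMv : ∀ i, ∑ j, M i j * v j = μ * v i := fun i => by
      have := congrFun hv.apply_eq_smul i
      simpa [Matrix.mulVec, dotProduct] using this
    -- Test the eigenvalue equation in the row where `|v i|` is largest: there `v j * v i ≤ v i * v
    -- i`, and the signs of the off-diagonal entries reverse this. Symmetry of `M` plays no role.
    obtain ⟨i, hi⟩ := Finite.exists_max fun i => |v i|
    have hvi : 0 < |v i| := by
      rw [abs_pos]
      intro h0
      refine hv.2 (funext fun j => ?_)
      have := hi j
      rw [h0, abs_zero] at this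
      simpa using this
    have key : σ * (v i * v i) ≤ μ * (v i * v i) := by
      have h1 : μ * (v i * v i) = ∑ j, M i j * (v j * v i) := by
        rw [← mul_assoc, ← hMv i, Finset.sum_mul]
        exact Finset.sum_congr rfl fun j _ => by ring
      rw [h1, ← hσ i, Finset.sum_mul]
      refine Finset.sum_le_sum fun j _ => ?_
      by_cases hij : i = j
      · rw [hij]
      · refine mul_le_mul_of_nonpos_left ?_ (hM i j hij)
        calc v j * v i ≤ |v j| * |v i| := by rw [← abs_mul]; exact le_abs_self _
          _ ≤ |v i| * |v i| := mul_le_mul_of_nonneg_right (hi j) (abs_nonneg _)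
          _ = v i * v i := abs_mul_abs_self _
    exact le_of_mul_le_mul_right key (by rw [← abs_mul_abs_self]; positivity)

end Eigenvalue

/-! ### Geometry of the polygon and the formula for `Λ₁`. -/

section Polygon

/-- The angular coordinate of the `j`-th vertex of the regular `k`-gon. -/
noncomputable def polygonAngle (k : ℕ) (j : ℕ) : ℝ := 2 * Real.pi * j / k

theorem inner_polygonPoint (n k : ℕ) (r : ℝ) (i j : Fin k) :
    inner ℝ (polygonPoint (n + 2) k r i) (polygonPoint (n + 2) k r j) =
      r ^ 2 * Real.cos (polygonAngle k i - polygonAngle k j) := by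
  rw [PiLp.inner_apply, Fin.sum_univ_succ, Fin.sum_univ_succ, Finset.sum_eq_zero, Real.cos_sub]
  · simp [polygonPoint, polygonAngle]
    ring
  · intro l _
    simp [polygonPoint]

theorem norm_polygonPoint (n k : ℕ) {r : ℝ} (hr : 0 ≤ r) (i : Fin k) :
    ‖polygonPoint (n + 2) k r i‖ = r := by
  have h := inner_polygonPoint n k r i i
  rw [real_inner_self_eq_norm_sq, sub_self, Real.cos_zero, mul_one] at h
  exact (sq_eq_sq₀ (norm_nonneg _) hr).1 h

theorem polygonPoint_injective (n : ℕ) {k : ℕ} {r : ℝ} (hr : 0 < r) :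
    Function.Injective (polygonPoint (n + 2) k r) := by
  intro i j hij
  have h := inner_polygonPoint n k r i j
  rw [← hij, real_inner_self_eq_norm_sq, norm_polygonPoint n k hr.le, eq_comm,
    mul_eq_left₀ (by positivity), Real.cos_eq_one_iff] at h
  obtain ⟨m, hm⟩ := h
  have hk : (k : ℝ) ≠ 0 := by exact_mod_cast (Nat.zero_lt_of_lt i.2).ne'
  have h1 : ((m * k : ℤ) : ℝ) = ((i : ℤ) - (j : ℤ) : ℤ) := by
    have hp := Real.pi_ne_zero
    unfold polygonAngle at hm
    push_cast
    field_simp at hm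
    exact hm
  have h2 : m * (k : ℤ) = (i : ℤ) - (j : ℤ) := by exact_mod_cast h1
  have hi := i.2
  have hj := j.2
  have hm0 : m = 0 := by
    by_contra hne
    rcases lt_or_gt_of_ne hne with h | h
    · have : m * (k : ℤ) ≤ -1 * k := by gcongr; omega
      omega
    · have : 1 * (k : ℤ) ≤ m * k := by gcongr; omega
      omega
  rw [hm0, zero_mul] at h2
  exact Fin.ext (by omega)

/-- Reindexing by `j ↦ i - j` in `Fin k` changes angles by multiples of `2π` only; this is the
constancy of the row sums. -/
theorem sum_cos_polygonAngle_sub {k : ℕ} (F : ℝ → ℝ) (i : Fin k) :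
    ∑ j : Fin k, F (Real.cos (polygonAngle k i - polygonAngle k j)) =
      ∑ j : Fin k, F (Real.cos (polygonAngle k j)) := by
  have : NeZero k := ⟨(Nat.zero_lt_of_lt i.2).ne'⟩
  have hk : (k : ℝ) ≠ 0 := by exact_mod_cast NeZero.ne k
  rw [← Equiv.sum_comp (Equiv.subLeft i) fun j : Fin k => F (Real.cos (polygonAngle k j))]
  refine Finset.sum_congr rfl fun j _ => ?_
  congr 1
  rw [Equiv.subLeft_apply, Fin.val_sub]
  set a : ℕ := k - j + i with ha
  have h1 : (a : ℝ) = k - (j : ℕ) + (i : ℕ) := by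
    rw [ha]
    push_cast [j.2.le]
    ring
  obtain ⟨b, hb⟩ : ∃ b, a % k + k * b = a := ⟨a / k, Nat.mod_add_div a k⟩
  have h2 : (a : ℝ) = ((a % k : ℕ) : ℝ) + k * (b : ℝ) := by exact_mod_cast hb.symm
  -- The `-1` undoes the `k` added in `a = k - j + i` to avoid natural subtraction below zero.
  have h3 : polygonAngle k i - polygonAngle k j =
      polygonAngle k (a % k) + ((b : ℤ) - 1 : ℤ) * (2 * Real.pi) := by
    unfold polygonAngle
    push_cast
    field_simp
    linarith
  rw [h3, Real.cos_add_int_mul_two_pi]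

variable {E : Type*} [NormedAddCommGroup E] [InnerProductSpace ℝ E]

omit [InnerProductSpace ℝ E] in
theorem norm_pow_inv_eq_gegenbauerKernel {n : ℕ} {v : E} {m t z : ℝ} (hm : 0 ≤ m)
    (h : ‖v‖ ^ 2 = m ^ 2 * (1 - 2 * z * t + z ^ 2)) :
    (‖v‖ ^ n)⁻¹ = (m ^ n)⁻¹ * gegenbauerKernel n t z := by
  have h1 : ‖v‖ = m * √(1 - 2 * z * t + z ^ 2) := by
    rw [← Real.sqrt_sq (norm_nonneg v), h, Real.sqrt_mul (sq_nonneg m), Real.sqrt_sq hm]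
  rw [h1, mul_pow, mul_inv, gegenbauerKernel]

/-- At equal radii the second and fourth image series coincide, whence the factor `2`; pulling out
the scales `1`, `r`, `r²`, `r` leaves kernels at multiples of `r²`, `ρ²`, `ρ²/r²`, `ρ²`. -/
theorem annulusImages_of_norm_eq {n : ℕ} {ρ r t : ℝ} {x y : E} (hr : 0 < r) (hx : ‖x‖ = r)
    (hy : ‖y‖ = r) (hxy : inner ℝ x y = r ^ 2 * t) :
    annulusImages n ρ y x = dilationSeries (ρ ^ n) (ρ ^ 2) (gegenbauerKernel n t) (r ^ 2)
      - 2 * ρ ^ n * (r ^ n)⁻¹ * dilationSeries (ρ ^ n) (ρ ^ 2) (gegenbauerKernel n t) (ρ ^ 2)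
      + ρ ^ n * (r ^ n)⁻¹ ^ 2 *
        dilationSeries (ρ ^ n) (ρ ^ 2) (gegenbauerKernel n t) (ρ ^ 2 / r ^ 2) := by
  have e1 : ∀ l : ℕ, (‖(‖y‖ * (ρ ^ 2) ^ l) • x - ‖y‖⁻¹ • y‖ ^ n)⁻¹ =
      gegenbauerKernel n t ((ρ ^ 2) ^ l * r ^ 2) := fun l => by
    rw [norm_pow_inv_eq_gegenbauerKernel (m := 1) zero_le_one, one_pow, inv_one, one_mul]
    rw [norm_smul_sub_smul_sq, hx, hy, hxy]
    field_simp
    ring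
  have e2 : ∀ l : ℕ, (‖(ρ ^ 2) ^ (l + 1) • x - (1 : ℝ) • y‖ ^ n)⁻¹ =
      (r ^ n)⁻¹ * gegenbauerKernel n t ((ρ ^ 2) ^ l * ρ ^ 2) := fun l => by
    apply norm_pow_inv_eq_gegenbauerKernel hr.le
    rw [norm_smul_sub_smul_sq, hx, hy, hxy]
    ring
  have e3 : ∀ l : ℕ, (‖‖y‖ • x - ((ρ ^ 2) ^ (l + 1) * ‖y‖⁻¹) • y‖ ^ n)⁻¹ =
      (r ^ n)⁻¹ ^ 2 * gegenbauerKernel n t ((ρ ^ 2) ^ l * (ρ ^ 2 / r ^ 2)) := fun l => by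
    rw [show (r ^ n)⁻¹ ^ 2 = ((r ^ 2) ^ n)⁻¹ by rw [inv_pow, ← pow_mul, ← pow_mul, mul_comm]]
    apply norm_pow_inv_eq_gegenbauerKernel (by positivity)
    rw [norm_smul_sub_smul_sq, hx, hy, hxy]
    field_simp
    ring
  have e4 : ∀ l : ℕ, (‖(1 : ℝ) • x - (ρ ^ 2) ^ (l + 1) • y‖ ^ n)⁻¹ =
      (r ^ n)⁻¹ * gegenbauerKernel n t ((ρ ^ 2) ^ l * ρ ^ 2) := fun l => by
    apply norm_pow_inv_eq_gegenbauerKernel hr.le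
    rw [norm_smul_sub_smul_sq, hx, hy, hxy]
    ring
  have f2 : ∀ l : ℕ, (ρ ^ n) ^ (l + 1) *
      ((r ^ n)⁻¹ * gegenbauerKernel n t ((ρ ^ 2) ^ l * ρ ^ 2)) =
      ρ ^ n * (r ^ n)⁻¹ * ((ρ ^ n) ^ l * gegenbauerKernel n t ((ρ ^ 2) ^ l * ρ ^ 2)) :=
    fun l => by ring
  have f3 : ∀ l : ℕ, (ρ ^ n) ^ (l + 1) *
      ((r ^ n)⁻¹ ^ 2 * gegenbauerKernel n t ((ρ ^ 2) ^ l * (ρ ^ 2 / r ^ 2))) =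
      ρ ^ n * (r ^ n)⁻¹ ^ 2 *
        ((ρ ^ n) ^ l * gegenbauerKernel n t ((ρ ^ 2) ^ l * (ρ ^ 2 / r ^ 2))) :=
    fun l => by ring
  simp only [annulusImages, imageSum, dilationSeries, e1, e2, e3, e4, f2, f3, tsum_mul_left]
  ring

theorem sum_dilationSeries_gegenbauerKernel {n k : ℕ} (hn : 1 ≤ n) (hk : 1 ≤ k) {w q z : ℝ}
    (hw : w ∈ Ioo (0 : ℝ) 1) (hq : q ∈ Ioo (0 : ℝ) 1) (hz : z ∈ Ico (0 : ℝ) 1) :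
    ∑ j : Fin k, dilationSeries w q (gegenbauerKernel n (Real.cos (polygonAngle k j))) z =
      dilationSeries w q (polygonKernel n k) z := by
  have h0 : 0 ≤ polygonKernel n k 0 := Finset.sum_nonneg fun j _ => gegenbauerKernel_nonneg n _ _
  have hs := summable_dilationSeries hw hq (monotoneOn_polygonKernel hn hk) h0 hz
  simp only [dilationSeries]
  rw [← Summable.tsum_finsetSum]
  · simp only [polygonKernel, Finset.mul_sum, polygonAngle]
  · intro j _
    refine Summable.of_nonneg_of_le
      (fun l => mul_nonneg (pow_nonneg hw.1.le l) (gegenbauerKernel_nonneg n _ _))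
      (fun l => mul_le_mul_of_nonneg_left ?_ (pow_nonneg hw.1.le l)) hs
    exact Finset.single_le_sum (f := fun j : Fin k =>
      gegenbauerKernel n (Real.cos (2 * Real.pi * (j : ℕ) / k)) (q ^ l * z))
      (fun j _ => gegenbauerKernel_nonneg n _ _) (Finset.mem_univ j)

theorem Lambda1_eq {n k : ℕ} (hn : 1 ≤ n) (hk : 1 ≤ k) {ρ r : ℝ} (hρ : ρ ∈ Ioo (0 : ℝ) 1)
    (hr : r ∈ Ioo ρ 1) :
    Lambda1 (n + 2) k ρ r = newtonConst n *
      (dilationSeries (ρ ^ n) (ρ ^ 2) (polygonKernel n k) (r ^ 2)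
      - (2 * ρ ^ n * dilationSeries (ρ ^ n) (ρ ^ 2) (polygonKernel n k) (ρ ^ 2) +
          polygonKernel n k 1) * (r ^ n)⁻¹
      + ρ ^ n * ((r ^ n)⁻¹ ^ 2 *
        dilationSeries (ρ ^ n) (ρ ^ 2) (polygonKernel n k) (ρ ^ 2 / r ^ 2))) := by
  have hρ0 := hρ.1
  have hr0 : 0 < r := hρ0.trans hr.1
  have hw : ρ ^ n ∈ Ioo (0 : ℝ) 1 := ⟨by positivity, pow_lt_one₀ hρ0.le hρ.2 (by omega)⟩
  have hq : ρ ^ 2 ∈ Ioo (0 : ℝ) 1 := ⟨by positivity, pow_lt_one₀ hρ0.le hρ.2 two_ne_zero⟩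
  have hz1 : r ^ 2 ∈ Ico (0 : ℝ) 1 := ⟨by positivity, pow_lt_one₀ hr0.le hr.2 two_ne_zero⟩
  have hz2 : ρ ^ 2 / r ^ 2 ∈ Ico (0 : ℝ) 1 := by
    refine ⟨by positivity, ?_⟩
    rw [div_lt_one (by positivity)]
    exact pow_lt_pow_left₀ hr.1 hρ0.le two_ne_zero
  have hmem : ∀ i : Fin k, polygonPoint (n + 2) k r i ∈ annulus (n + 2) ρ := fun i => by
    simpa [annulus, norm_polygonPoint n k hr0.le] using hr
  set F : ℝ → ℝ := fun t =>
    newtonConst n * (dilationSeries (ρ ^ n) (ρ ^ 2) (gegenbauerKernel n t) (r ^ 2)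
      - 2 * ρ ^ n * (r ^ n)⁻¹ * dilationSeries (ρ ^ n) (ρ ^ 2) (gegenbauerKernel n t) (ρ ^ 2)
      + ρ ^ n * (r ^ n)⁻¹ ^ 2 *
        dilationSeries (ρ ^ n) (ρ ^ 2) (gegenbauerKernel n t) (ρ ^ 2 / r ^ 2)
      - (r ^ n)⁻¹ * gegenbauerKernel n t 1) with hF
  have hfund : ∀ i j : Fin k,
      fundamentalSolution (polygonPoint (n + 2) k r i) (polygonPoint (n + 2) k r j) =
      newtonConst n * ((r ^ n)⁻¹ *
        gegenbauerKernel n (Real.cos (polygonAngle k i - polygonAngle k j)) 1) := fun i j => by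
    rw [fundamentalSolution_eq, norm_pow_inv_eq_gegenbauerKernel hr0.le]
    rw [norm_sub_sq_real, inner_polygonPoint, norm_polygonPoint n k hr0.le,
      norm_polygonPoint n k hr0.le]
    ring
  have hentry : ∀ i j : Fin k,
      greenMatrix (annulus (n + 2) ρ) (polygonPoint (n + 2) k r) i j =
      F (Real.cos (polygonAngle k i - polygonAngle k j)) := fun i j => by
    -- One formula covers the diagonal too, since `fundamentalSolution x x = 0` by the convention
    -- for division by zero. Likewise the term `j = 0` of `polygonKernel n k 1` is zero.
    have h1 : greenMatrix (annulus (n + 2) ρ) (polygonPoint (n + 2) k r) i j =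
        regularPart (annulus (n + 2) ρ) (polygonPoint (n + 2) k r i)
          (polygonPoint (n + 2) k r j) -
        fundamentalSolution (polygonPoint (n + 2) k r i) (polygonPoint (n + 2) k r j) := by
      by_cases hij : i = j
      · subst hij
        simp [greenMatrix, robin, fundamentalSolution_eq, show n ≠ 0 by omega]
      · simp [greenMatrix, hij, green]
    rw [h1, regularPart_annulus hn hρ (hmem i) (hmem j), hfund,
      annulusImages_of_norm_eq hr0 (norm_polygonPoint n k hr0.le i)
        (norm_polygonPoint n k hr0.le j) (inner_polygonPoint n k r i j)]
    simp only [hF]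
    ring
  refine firstEigenvalue_eq_of_sum_eq hk (fun i j hij => ?_) fun i => ?_
  · simp only [greenMatrix, Matrix.of_apply, if_neg hij, neg_nonpos]
    exact green_annulus_nonneg hn hρ (hmem i) (hmem j)
      fun h => hij (polygonPoint_injective n hr0 h)
  · simp_rw [hentry]
    rw [sum_cos_polygonAngle_sub F i]
    simp only [hF]
    rw [← Finset.mul_sum, Finset.sum_sub_distrib, Finset.sum_add_distrib, Finset.sum_sub_distrib,
      ← Finset.mul_sum, ← Finset.mul_sum, ← Finset.mul_sum,
      sum_dilationSeries_gegenbauerKernel hn hk hw hq hz1,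
      sum_dilationSeries_gegenbauerKernel hn hk hw hq hz2,
      sum_dilationSeries_gegenbauerKernel hn hk hw hq (Ioo_subset_Ico_self hq)]
    simp only [polygonKernel, polygonAngle]
    ring

end Polygon

end AnnulusGreen

theorem proposition4p1 (N k : ℕ) (hN : 3 ≤ N) (hk : 2 ≤ k) (ρ : ℝ) (hρ : ρ ∈ Set.Ioo (0 : ℝ) 1) :
    DifferentiableOn ℝ (AnnulusGreen.Lambda1 N k ρ) (Set.Ioo ρ 1) ∧
      ∃ r₀ ∈ Set.Ioo ρ 1,
        (∀ r ∈ Set.Ioo ρ 1, deriv (AnnulusGreen.Lambda1 N k ρ) r = 0 ↔ r = r₀) ∧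
        IsMinOn (AnnulusGreen.Lambda1 N k ρ) (Set.Ioo ρ 1) r₀ := by
  obtain ⟨n, rfl⟩ : ∃ n, N = n + 2 := ⟨N - 2, by omega⟩
  have hn : 1 ≤ n := by omega
  have hk : 1 ≤ k := by omega
  have hw : ρ ^ n ∈ Set.Ioo (0 : ℝ) 1 :=
    ⟨pow_pos hρ.1 n, pow_lt_one₀ hρ.1.le hρ.2 (by omega)⟩
  have hq : ρ ^ 2 ∈ Set.Ioo (0 : ℝ) 1 :=
    ⟨pow_pos hρ.1 2, pow_lt_one₀ hρ.1.le hρ.2 two_ne_zero⟩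
  have hm := AnnulusGreen.monotoneOn_polygonKernel hn hk
  have hc := AnnulusGreen.convexOn_polygonKernel hn hk
  have hK := fun {z : ℝ} (hz : z ∈ Set.Ico (0 : ℝ) 1) =>
    AnnulusGreen.inv_one_sub_le_polygonKernel hn hk hz
  have h0 : 0 ≤ AnnulusGreen.polygonKernel n k 0 :=
    Finset.sum_nonneg fun j _ => AnnulusGreen.gegenbauerKernel_nonneg n _ _
  have hd : ∀ z ∈ Set.Ioo (0 : ℝ) 1, DifferentiableAt ℝ (AnnulusGreen.polygonKernel n k) z :=
    fun z hz => AnnulusGreen.differentiableAt_polygonKernel (by rw [abs_of_pos hz.1]; exact hz.2)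
  exact AnnulusGreen.unique_critical_point hn hρ (AnnulusGreen.newtonConst_pos hn)
    (AnnulusGreen.monotoneOn_dilationSeries hw hq hm h0)
    (AnnulusGreen.convexOn_dilationSeries hw hq hm hc h0)
    (fun z hz => AnnulusGreen.differentiableAt_dilationSeries hw hq hm hc h0 hd hz)
    (fun z hz => (hK hz).trans (AnnulusGreen.le_dilationSeries hw hq hm h0 hz))
    fun r hr => AnnulusGreen.Lambda1_eq hn hk hρ hr
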